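/- Let $X$ and $Y$ be locally compact Hausdorff spaces. A twisted topological $Y$-$X$-correspondence $(Z,r,s,\mathcal L)$ consists of a locally compact Hausdorff space $Z$, a continuous map $r:Z\to Y$, a local homeomorphism $s:Z\to X$, and a Hermitian line bundle $\mathcal L$ over $Z$ (a complex line bundle with a continuous fibrewise inner product). It is called proper if $r$ is proper and $s$ is proper as a map onto its image $s(Z)$. For a proper $(Z,r,s,\mathcal L)$, let $\Gamma_0(Z,r,s,\mathcal L)$ be the $C^*$-correspondence from $C_0(Y)$ to $C_0(X)$ that consists of the continuous sections $\xi$ of $\mathcal L$ for which the function $\langle\xi,\xi\rangle$ belongs to $C_0(X)$, where $$\langle\xi,\eta\rangle(x)=\sum_{s(z)=x}\langle\xi(z),\eta(z)\rangle_{\mathcal L},\qquad (\xi f)(z)=\xi(z)f(s(z)),\qquad (\varphi(g)\xi)(z)=g(r(z))\xi(z)$$ for $f\in C_0(X)$, $g\in C_0(Y)$. (If the fibres of $s$ have bounded cardinality, these are exactly the continuous sections of $\mathcal L$ that vanish at infinity.) Two twisted topological $Y$-$X$-correspondences $(Z,r,s,\mathcal L)$ and $(Z',r',s',\mathcal L')$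 are locally conjugate if every $x\in X$ has an open neighborhood $U$ for which there is a homeomorphism $\phi:s^{-1}(U)\to (s')^{-1}(U)$ with $s'\circ\phi=s$ and $r'\circ\phi=r$ on $s^{-1}(U)$ (no condition is imposed on the line bundles). Two $C^*$-correspondences $\mathcal E,\mathcal F$ from $C_0(Y)$ to $C_0(X)$ are locally isomorphic if every $x\in X$ has an open neighborhood $U$ such that $\mathcal E_U=\mathcal E\,C_0(U)$ and $\mathcal F_U=\mathcal F\,C_0(U)$, with the restricted structures, are isomorphic as $C^*$-correspondences from $C_0(Y)$ to $C_0(U)$, i.e. there is a linear inner-product preserving bijection $\mathcal E_U\to\mathcal F_U$ intertwining the right actions of $C_0(U)$ and the left actions of $C_0(Y)$. Proposition. Let $(Z,r,s,\mathcal L)$ and $(Z',r',s',\mathcal L')$ be proper twisted topological $Y$-$X$-correspondences, and assume that at least one of the images $s(Z)$, $s'(Z')$ is closed in $X$ (for instance, that $s$ or $s'$ is surjective). Then the following are equivalent: (a) $(Z,r,s,\mathcal L)$ and $(Z',r',s',\mathcal L')$ are locally conjugate; (b) the $C^*$-correspondences $\Gamma_0(Z,r,s,\mathcal L)$ and $\Gamma_0(Z',r',s',\mathcal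 L')$ are locally isomorphic. -/

import Mathlib

open scoped ZeroAtInfty ComplexOrder
open Topology Bundle Filter TopologicalSpace

namespace C0

section Order
variable {X : Type*} [TopologicalSpace X]

/-- The pointwise order on `C₀(X)`; it is the usual order of the C*-algebra `C₀(X)`. -/
noncomputable instance instPartialOrder : PartialOrder C₀(X, ℂ) :=
  PartialOrder.lift (fun f : C₀(X, ℂ) => (f : X → ℂ)) DFunLike.coe_injective

theorem le_def (f g : C₀(X, ℂ)) : f ≤ g ↔ ∀ x, f x ≤ g x := Iff.rfl

instance instStarOrderedRing : StarOrderedRing C₀(X, ℂ) := by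
  refine StarOrderedRing.of_le_iff fun f g => ⟨fun h => ?_, ?_⟩
  · refine ⟨⟨⟨fun x => ((Real.sqrt ((g x - f x).re) : ℝ) : ℂ), by fun_prop⟩, ?_⟩, ?_⟩
    · have h1 : Tendsto (fun x => g x - f x) (cocompact X) (𝓝 0) := by
        simpa using (zero_at_infty g).sub (zero_at_infty f)
      have h2 : Continuous fun w : ℂ => ((Real.sqrt w.re : ℝ) : ℂ) := by fun_prop
      have h3 := (h2.tendsto 0).comp h1
      simp only [Complex.zero_re, Real.sqrt_zero, Complex.ofReal_zero] at h3
      exact h3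
    · ext x
      have hx := (le_def f g).1 h x
      rw [Complex.le_def] at hx
      have h0 : 0 ≤ (g x - f x).re := by simpa using hx.1
      have : ((Real.sqrt ((g x - f x).re) : ℝ) : ℂ) * ((Real.sqrt ((g x - f x).re) : ℝ) : ℂ)
          = g x - f x := by
        rw [← Complex.ofReal_mul, Real.mul_self_sqrt h0]
        apply Complex.ext <;> simp [hx.2]
      change g x = f x + star ((Real.sqrt ((g x - f x).re) : ℝ) : ℂ) * _
      rw [Complex.star_def, Complex.conj_ofReal]
      change g x = f x + ((Real.sqrt ((g x - f x).re) : ℝ) : ℂ) * ((Real.sqrt ((g x - f x).re) : ℝ) : ℂ)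
      rw [this]; ring
  · rintro ⟨s, rfl⟩ x
    have : 0 ≤ star (s x) * s x := star_mul_self_nonneg _
    simpa using this

end Order

section Cutoff
variable {X : Type*} [TopologicalSpace X]

theorem isCompact_le_norm (f : C₀(X, ℂ)) {ε : ℝ} (hε : 0 < ε) : IsCompact {x | ε ≤ ‖f x‖} := by
  have h := (zero_at_infty f).eventually (Metric.ball_mem_nhds (0 : ℂ) hε)
  rw [Filter.Eventually, mem_cocompact] at h
  obtain ⟨K, hK, hKs⟩ := h
  refine hK.of_isClosed_subset (isClosed_le continuous_const (map_continuous f).norm) ?_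
  intro x hx
  by_contra hxK
  have := hKs hxK
  have h1 : ‖f x‖ < ε := by simpa using this
  have h2 : ε ≤ ‖f x‖ := hx
  linarith

theorem tendsto_of_compact (f : X → ℂ)
    (h : ∀ ε : ℝ, 0 < ε → ∃ K, IsCompact K ∧ ∀ x ∉ K, ‖f x‖ < ε) :
    Tendsto f (cocompact X) (𝓝 0) := by
  rw [Metric.tendsto_nhds]
  intro ε hε
  obtain ⟨K, hK, hK'⟩ := h ε hε
  filter_upwards [hK.compl_mem_cocompact] with x hx
  simpa using hK' x hx

/-- An element of `C₀(X)` which vanishes off the open set `U`, as an element of `C₀(U)`. -/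
noncomputable def restrict (U : Opens X) (f : C₀(X, ℂ)) (hf : ∀ x ∉ U, f x = 0) : C₀(U, ℂ) where
  toFun x := f x
  continuous_toFun := by fun_prop
  zero_at_infty' := tendsto_of_compact _ fun ε hε => by
    refine ⟨Subtype.val ⁻¹' {x | ε ≤ ‖f x‖}, ?_, fun x hx => by simpa using hx⟩
    have himg : Subtype.val '' (Subtype.val ⁻¹' {x | ε ≤ ‖f x‖} : Set U) = {x | ε ≤ ‖f x‖} := by
      refine Set.Subset.antisymm (Set.image_preimage_subset _ _) fun x hx => ?_
      by_cases hxU : x ∈ U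
      · exact ⟨⟨x, hxU⟩, hx, rfl⟩
      · have hx' : ε ≤ ‖f x‖ := hx
        rw [hf x hxU, norm_zero] at hx'
        linarith
    rw [Subtype.isCompact_iff, himg]
    exact isCompact_le_norm f hε

theorem norm_le_iff {Y : Type*} [TopologicalSpace Y] (f : C₀(Y, ℂ)) {c : ℝ} (hc : 0 ≤ c) :
    ‖f‖ ≤ c ↔ ∀ x, ‖f x‖ ≤ c := by
  rw [← ZeroAtInftyContinuousMap.norm_toBCF_eq_norm, BoundedContinuousFunction.norm_le hc]
  rfl

theorem norm_apply_le {Y : Type*} [TopologicalSpace Y] (f : C₀(Y, ℂ)) (x : Y) : ‖f x‖ ≤ ‖f‖ :=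
  (norm_le_iff f (norm_nonneg _)).1 le_rfl x

theorem norm_restrict (U : Opens X) (f : C₀(X, ℂ)) (hf : ∀ x ∉ U, f x = 0) :
    ‖restrict U f hf‖ = ‖f‖ := by
  apply le_antisymm
  · exact (norm_le_iff _ (norm_nonneg _)).2 fun x => norm_apply_le f x
  · refine (norm_le_iff _ (norm_nonneg _)).2 fun x => ?_
    by_cases hx : x ∈ U
    · exact norm_apply_le (restrict U f hf) ⟨x, hx⟩
    · rw [hf x hx, norm_zero]; exact norm_nonneg _

variable [T2Space X]

/-- A function that is continuous on the open set `U`, and is small off compact subsets of `U`,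
is an element of `C₀(X)`. -/
def mk (U : Set X) (hU : IsOpen U) (f : X → ℂ) (hf : ContinuousOn f U)
    (h : ∀ ε : ℝ, 0 < ε → ∃ K, IsCompact K ∧ K ⊆ U ∧ ∀ x ∉ K, ‖f x‖ < ε) : C₀(X, ℂ) where
  toFun := f
  continuous_toFun := by
    rw [continuous_iff_continuousAt]
    intro x
    by_cases hx : x ∈ U
    · exact hf.continuousAt (hU.mem_nhds hx)
    · have h0 : f x = 0 := by
        by_contra h0
        obtain ⟨K, -, hKU, hK⟩ := h _ (norm_pos_iff.2 h0)
        exact lt_irrefl _ (hK x fun hxK => hx (hKU hxK))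
      rw [ContinuousAt, h0, Metric.tendsto_nhds]
      intro ε hε
      obtain ⟨K, hK, hKU, hK'⟩ := h ε hε
      filter_upwards [hK.isClosed.isOpen_compl.mem_nhds fun hxK => hx (hKU hxK)] with y hy
      simpa using hK' y hy
  zero_at_infty' := tendsto_of_compact f fun ε hε =>
    let ⟨K, hK, _, hK'⟩ := h ε hε
    ⟨K, hK, hK'⟩

open Classical in
/-- The inclusion `C₀(U) ⊆ C₀(X)` for an open subset `U` of `X`, by extension by zero. -/
noncomputable def extendZero (U : Opens X) (g : C₀(U, ℂ)) : C₀(X, ℂ) :=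
  mk (U : Set X) U.isOpen (fun x => if hx : x ∈ U then g ⟨x, hx⟩ else 0)
    (by
      rw [continuousOn_iff_continuous_domRestrict]
      refine (map_continuous g).congr fun x => ?_
      simp [Set.domRestrict_apply])
    (fun ε hε => ⟨Subtype.val '' {x : U | ε ≤ ‖g x‖},
      (isCompact_le_norm g hε).image continuous_subtype_val, by rintro _ ⟨x, -, rfl⟩; exact x.2,
      fun x hx => by
        by_cases hxU : x ∈ U
        · rw [dif_pos hxU]
          by_contra hlt
          exact hx ⟨⟨x, hxU⟩, not_lt.1 hlt, rfl⟩
        · rw [dif_neg hxU]; simpa using hε⟩)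

theorem extendZero_apply (U : Opens X) (g : C₀(U, ℂ)) (x : U) : extendZero U g x = g x :=
  dif_pos x.2

theorem extendZero_of_notMem (U : Opens X) (g : C₀(U, ℂ)) {x : X} (hx : x ∉ U) :
    extendZero U g x = 0 :=
  dif_neg hx

end Cutoff
end C0

/-- A C*-correspondence from `C₀(Y)` to `C₀(X)`: a Hilbert `C₀(X)`-module together with a
*-homomorphism from `C₀(Y)` to its adjointable operators. As `C₀(X)` is commutative,
the right action of `f` on `ξ` is written `f • ξ`. The inner product is conjugate linear in the
first variable. -/
structure CStarCorrespondence (Y : Type*) (X : Type*) [TopologicalSpace Y] [TopologicalSpace X] where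
  Carrier : Type*
  [normedAddCommGroup : NormedAddCommGroup Carrier]
  [normedSpace : NormedSpace ℂ Carrier]
  [smul : SMul C₀(X, ℂ) Carrier]
  [cstarModule : CStarModule C₀(X, ℂ) Carrier]
  [complete : CompleteSpace Carrier]
  leftAction : C₀(Y, ℂ) →ₙₐ[ℂ] (Carrier →L[ℂ] Carrier)
  inner_leftAction : ∀ (f : C₀(Y, ℂ)) (ξ η : Carrier),
    inner C₀(X, ℂ) (leftAction f ξ) η = inner C₀(X, ℂ) ξ (leftAction (star f) η)

namespace CStarCorrespondence

attribute [instance] normedAddCommGroup normedSpace smul cstarModule complete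

section Basic
variable {Y X : Type*} [TopologicalSpace Y] [TopologicalSpace X]

/-- An isomorphism of C*-correspondences is a linear bijection which preserves the inner
products and intertwines the right and the left actions. -/
def Isomorphic (E : CStarCorrespondence Y X) (F : CStarCorrespondence Y X) : Prop :=
  ∃ T : E.Carrier ≃ₗ[ℂ] F.Carrier,
    (∀ ξ η, inner C₀(X, ℂ) (T ξ) (T η) = inner C₀(X, ℂ) ξ η) ∧
    (∀ (f : C₀(X, ℂ)) (ξ : E.Carrier), T (f • ξ) = f • T ξ) ∧
    (∀ (g : C₀(Y, ℂ)) (ξ : E.Carrier), T (E.leftAction g ξ) = F.leftAction g (T ξ))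

theorem ext_inner {E : CStarCorrespondence Y X} {ξ η : E.Carrier}
    (h : ∀ ζ, inner C₀(X, ℂ) ζ ξ = inner C₀(X, ℂ) ζ η) : ξ = η := by
  rw [← sub_eq_zero, ← CStarModule.inner_self (A := C₀(X, ℂ)), CStarModule.inner_sub_right, h,
    sub_self]

theorem leftAction_smul (E : CStarCorrespondence Y X) (g : C₀(Y, ℂ)) (f : C₀(X, ℂ))
    (ξ : E.Carrier) : E.leftAction g (f • ξ) = f • E.leftAction g ξ := by
  have key : ∀ ζ η, inner C₀(X, ℂ) ζ (E.leftAction g η)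
      = inner C₀(X, ℂ) (E.leftAction (star g) ζ) η := fun ζ η => by
    rw [E.inner_leftAction, star_star]
  refine ext_inner fun ζ => ?_
  rw [key, CStarModule.inner_op_smul_right, CStarModule.inner_op_smul_right, key]

theorem continuous_inner_apply (E : CStarCorrespondence Y X) (ζ : E.Carrier) (x : X) :
    Continuous fun η : E.Carrier => (inner C₀(X, ℂ) ζ η) x := by
  have h1 : Continuous fun η : E.Carrier => inner C₀(X, ℂ) ζ η :=
    (CStarModule.continuous_inner (A := C₀(X, ℂ)) (E := E.Carrier)).comp
      (Continuous.prodMk_right ζ)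
  have h2 : Continuous fun f : C₀(X, ℂ) => f x :=
    (continuous_eval_const (F := BoundedContinuousFunction X ℂ) x).comp
      ZeroAtInftyContinuousMap.isometry_toBCF.continuous
  exact h2.comp h1

end Basic

section Restrict
variable {Y X : Type*} [TopologicalSpace Y] [TopologicalSpace X] [T2Space X]

/-- The closed submodule `E C₀(U)`, for `U` an open subset of `X`. -/
def restrictSubmodule (E : CStarCorrespondence Y X) (U : Opens X) : Submodule ℂ E.Carrier :=
  (Submodule.span ℂ
    {η | ∃ (g : C₀(U, ℂ)) (ξ : E.Carrier), η = C0.extendZero U g • ξ}).topologicalClosure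

theorem extendZero_smul_mem (E : CStarCorrespondence Y X) (U : Opens X) (g : C₀(U, ℂ))
    (ξ : E.Carrier) : C0.extendZero U g • ξ ∈ E.restrictSubmodule U :=
  Submodule.le_topologicalClosure _ (Submodule.subset_span ⟨g, ξ, rfl⟩)

theorem restrictSubmodule_induction (E : CStarCorrespondence Y X) (U : Opens X)
    (S : Submodule ℂ E.Carrier) (hS : IsClosed (S : Set E.Carrier))
    (h : ∀ (g : C₀(U, ℂ)) (ξ : E.Carrier), C0.extendZero U g • ξ ∈ S) :
    E.restrictSubmodule U ≤ S :=
  Submodule.topologicalClosure_minimal _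
    (Submodule.span_le.2 (by rintro _ ⟨g, ξ, rfl⟩; exact h g ξ)) hS

theorem inner_eq_zero_of_notMem (E : CStarCorrespondence Y X) (U : Opens X) (ζ η : E.Carrier)
    (hη : η ∈ E.restrictSubmodule U) {x : X} (hx : x ∉ U) : (inner C₀(X, ℂ) ζ η) x = 0 := by
  let S : Submodule ℂ E.Carrier :=
    { carrier := {η | (inner C₀(X, ℂ) ζ η) x = 0}
      add_mem' := fun {a b} ha hb => by
        have ha' : (inner C₀(X, ℂ) ζ a) x = 0 := ha
        have hb' : (inner C₀(X, ℂ) ζ b) x = 0 := hb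
        change (inner C₀(X, ℂ) ζ (a + b)) x = 0
        rw [CStarModule.inner_add_right, ZeroAtInftyContinuousMap.add_apply, ha', hb', add_zero]
      zero_mem' := by
        change (inner C₀(X, ℂ) ζ (0 : E.Carrier)) x = 0
        rw [CStarModule.inner_zero_right, ZeroAtInftyContinuousMap.zero_apply]
      smul_mem' := fun c a ha => by
        have ha' : (inner C₀(X, ℂ) ζ a) x = 0 := ha
        change (inner C₀(X, ℂ) ζ (c • a)) x = 0
        rw [CStarModule.inner_smul_right_complex, ZeroAtInftyContinuousMap.smul_apply, ha',
          smul_zero] }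
  refine E.restrictSubmodule_induction U S
    (isClosed_singleton.preimage (E.continuous_inner_apply ζ x)) (fun g ξ => ?_) hη
  change (inner C₀(X, ℂ) ζ (C0.extendZero U g • ξ)) x = 0
  rw [CStarModule.inner_op_smul_right, ZeroAtInftyContinuousMap.mul_apply,
    C0.extendZero_of_notMem U g hx, zero_mul]

theorem leftAction_mem (E : CStarCorrespondence Y X) (U : Opens X) (f : C₀(Y, ℂ))
    {η : E.Carrier} (hη : η ∈ E.restrictSubmodule U) :
    E.leftAction f η ∈ E.restrictSubmodule U := by
  refine E.restrictSubmodule_induction U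
    ((E.restrictSubmodule U).comap (E.leftAction f : E.Carrier →ₗ[ℂ] E.Carrier))
    ((Submodule.isClosed_topologicalClosure _).preimage (E.leftAction f).continuous)
    (fun g ξ => ?_) hη
  change E.leftAction f (C0.extendZero U g • ξ) ∈ E.restrictSubmodule U
  rw [E.leftAction_smul]
  exact E.extendZero_smul_mem U g _

noncomputable instance restrictSMul (E : CStarCorrespondence Y X) (U : Opens X) :
    SMul C₀(U, ℂ) (E.restrictSubmodule U) where
  smul g ξ := ⟨C0.extendZero U g • (ξ : E.Carrier), E.extendZero_smul_mem U g ξ⟩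

/-- `E C₀(U)` is a Hilbert `C₀(U)`-module: the right action is the restriction of the action of
`C₀(X)` to `C₀(U) ⊆ C₀(X)`, and the inner product is that of `E`, which has values in
`C₀(U)`. -/
noncomputable instance restrictCStarModule (E : CStarCorrespondence Y X) (U : Opens X) :
    CStarModule C₀(U, ℂ) (E.restrictSubmodule U) where
  inner ξ η := C0.restrict U (inner C₀(X, ℂ) (ξ : E.Carrier) (η : E.Carrier))
    fun _ hx => E.inner_eq_zero_of_notMem U ξ η η.2 hx
  inner_add_right {ξ η ζ} := by
    ext x
    change (inner C₀(X, ℂ) (ξ : E.Carrier) ((η : E.Carrier) + (ζ : E.Carrier))) (x : X) = _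
    rw [CStarModule.inner_add_right]; rfl
  inner_self_nonneg {ξ} x :=
    (CStarModule.inner_self_nonneg (A := C₀(X, ℂ)) (x := (ξ : E.Carrier))) (x : X)
  inner_self {ξ} := by
    rw [← norm_eq_zero, C0.norm_restrict, norm_eq_zero, CStarModule.inner_self]
    exact ZeroMemClass.coe_eq_zero
  inner_op_smul_right {g ξ η} := by
    ext x
    change (inner C₀(X, ℂ) (ξ : E.Carrier) (C0.extendZero U g • (η : E.Carrier))) (x : X) = _
    rw [CStarModule.inner_op_smul_right, ZeroAtInftyContinuousMap.mul_apply, C0.extendZero_apply]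
    rfl
  inner_smul_right_complex {c ξ η} := by
    ext x
    change (inner C₀(X, ℂ) (ξ : E.Carrier) (c • (η : E.Carrier))) (x : X) = _
    rw [CStarModule.inner_smul_right_complex]; rfl
  star_inner ξ η := by
    ext x
    change star ((inner C₀(X, ℂ) (ξ : E.Carrier) (η : E.Carrier)) (x : X)) = _
    rw [← ZeroAtInftyContinuousMap.star_apply, CStarModule.star_inner]; rfl
  norm_eq_sqrt_norm_inner_self ξ := by
    rw [C0.norm_restrict, ← CStarModule.norm_eq_sqrt_norm_inner_self]; rfl

/-- The C*-correspondence `E_U = E C₀(U)` from `C₀(Y)` to `C₀(U)`. -/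
noncomputable def restrict (E : CStarCorrespondence Y X) (U : Opens X) :
    CStarCorrespondence Y U where
  Carrier := E.restrictSubmodule U
  complete := (Submodule.isClosed_topologicalClosure _).completeSpace_coe
  leftAction :=
    { toFun := fun f => ((E.leftAction f).comp (E.restrictSubmodule U).subtypeL).codRestrict
        (E.restrictSubmodule U) fun ξ => E.leftAction_mem U f ξ.2
      map_smul' := fun c f => by ext ξ; simp; rfl
      map_zero' := by ext ξ; simp
      map_add' := fun f g => by ext ξ; simp; rfl
      map_mul' := fun f g => by ext ξ; simp; rfl }
  inner_leftAction f ξ η := by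
    ext x
    exact congrArg (fun h : C₀(X, ℂ) => h x) (E.inner_leftAction f ξ η)

/-- Two C*-correspondences are locally isomorphic if every point of `X` has an open neighbourhood
`U` such that `E_U` and `F_U` are isomorphic. -/
def LocallyIsomorphic (E : CStarCorrespondence Y X) (F : CStarCorrespondence Y X) : Prop :=
  ∀ x : X, ∃ U : Opens X, x ∈ U ∧ (E.restrict U).Isomorphic (F.restrict U)

end Restrict
end CStarCorrespondence

/-- A topological correspondence from `Y` to `X` (with `Y` and `X` locally compact Hausdorff):
a locally compact Hausdorff space `Z` with a continuous range map `r : Z → Y` and a source map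
`s : Z → X` that is a local homeomorphism. -/
structure TopologicalCorrespondence (Y : Type*) (X : Type*) [TopologicalSpace Y]
    [TopologicalSpace X] where
  Z : Type*
  [topologicalSpace : TopologicalSpace Z]
  [t2Space : T2Space Z]
  [locallyCompactSpace : LocallyCompactSpace Z]
  r : Z → Y
  s : Z → X
  continuous_r : Continuous r
  isLocalHomeomorph_s : IsLocalHomeomorph s

namespace TopologicalCorrespondence

attribute [instance] topologicalSpace t2Space locallyCompactSpace

variable {Y X : Type*} [TopologicalSpace Y] [TopologicalSpace X]

/-- The range map is proper. -/
def LeftProper (T : TopologicalCorrespondence Y X) : Prop := IsProperMap T.r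

/-- The source map is proper as a map onto its image. -/
def RightProper (T : TopologicalCorrespondence Y X) : Prop :=
  IsProperMap (Set.rangeFactorization T.s)

/-- Left and right proper. -/
structure IsProper (T : TopologicalCorrespondence Y X) : Prop where
  left : T.LeftProper
  right : T.RightProper

/-- An isomorphism is a homeomorphism of the total spaces compatible with the source and the range
maps. -/
def Isomorphic (T : TopologicalCorrespondence Y X) (T' : TopologicalCorrespondence Y X) : Prop :=
  ∃ φ : T.Z ≃ₜ T'.Z, (∀ z, T'.s (φ z) = T.s z) ∧ (∀ z, T'.r (φ z) = T.r z)

/-- The correspondence `(s⁻¹(U), r|, s|)` from `Y` to the open subset `U` of `X`. -/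
def restrict (T : TopologicalCorrespondence Y X) (U : Opens X) :
    TopologicalCorrespondence Y U where
  Z := T.s ⁻¹' (U : Set X)
  locallyCompactSpace :=
    (U.isOpen.preimage T.isLocalHomeomorph_s.continuous).locallyCompactSpace
  r z := T.r z
  s z := ⟨T.s z, z.2⟩
  continuous_r := T.continuous_r.comp continuous_subtype_val
  isLocalHomeomorph_s := by
    refine IsLocalHomeomorph.of_comp (g := (Subtype.val : U → X)) ?_
      U.isOpen.isOpenEmbedding_subtypeVal.isLocalHomeomorph ?_
    · exact T.isLocalHomeomorph_s.comp
        (U.isOpen.preimage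
          T.isLocalHomeomorph_s.continuous).isOpenEmbedding_subtypeVal.isLocalHomeomorph
    · exact (T.isLocalHomeomorph_s.continuous.comp continuous_subtype_val).subtype_mk _

/-- Every point of `X` has an open neighbourhood over which the two correspondences are
isomorphic. -/
def LocallyConjugate (T : TopologicalCorrespondence Y X) (T' : TopologicalCorrespondence Y X) :
    Prop :=
  ∀ x : X, ∃ U : Opens X, x ∈ U ∧ (T.restrict U).Isomorphic (T'.restrict U)

/-- The sum of the values of `h` over the points of the fibre `s⁻¹(x)`. -/
noncomputable def fiberSum (T : TopologicalCorrespondence Y X) (h : T.Z → ℂ) (x : X) : ℂ :=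
  ∑ᶠ z : T.s ⁻¹' {x}, h z

theorem isOpen_range (T : TopologicalCorrespondence Y X) : IsOpen (Set.range T.s) :=
  T.isLocalHomeomorph_s.isOpenMap.isOpen_range

theorem finite_fiber {T : TopologicalCorrespondence Y X} (hT : T.RightProper) (x : X) :
    (T.s ⁻¹' {x}).Finite := by
  by_cases hx : x ∈ Set.range T.s
  · have h1 : T.s ⁻¹' {x} = Set.rangeFactorization T.s ⁻¹' {⟨x, hx⟩} := by
      ext z
      simp [Set.rangeFactorization, Subtype.ext_iff]
    have h2 : IsCompact (T.s ⁻¹' {x}) := by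
      rw [h1]; exact hT.isCompact_preimage isCompact_singleton
    refine h2.finite (.of_openPartialHomeomorph T.s subset_rfl fun z _ => ?_)
    obtain ⟨e, he, h⟩ := T.isLocalHomeomorph_s z
    exact ⟨e, he, h.symm⟩
  · have : T.s ⁻¹' {x} = ∅ := by
      ext z
      simp only [Set.mem_preimage, Set.mem_singleton_iff, Set.mem_empty_iff_false, iff_false]
      rintro rfl
      exact hx ⟨z, rfl⟩
    rw [this]; exact Set.finite_empty

theorem fiberSum_of_notMem (T : TopologicalCorrespondence Y X) (h : T.Z → ℂ) {x : X}
    (hx : x ∉ Set.range T.s) : T.fiberSum h x = 0 := by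
  have : IsEmpty (T.s ⁻¹' {x}) := ⟨fun z => hx ⟨z, z.2⟩⟩
  exact finsum_of_isEmpty _

theorem continuousOn_fiberSum {T : TopologicalCorrespondence Y X} (hT : T.RightProper)
    {h : T.Z → ℂ} (hh : Continuous h) : ContinuousOn (T.fiberSum h) (Set.range T.s) := by
  have hloc : IsLocalHomeomorph (Set.rangeFactorization T.s) :=
    IsLocalHomeomorph.of_comp (g := (Subtype.val : Set.range T.s → X)) T.isLocalHomeomorph_s
      T.isOpen_range.isOpenEmbedding_subtypeVal.isLocalHomeomorph hT.continuous
  have hfib (y : Set.range T.s) : Set.rangeFactorization T.s ⁻¹' {y} = T.s ⁻¹' {(y : X)} := by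
    ext z
    simp [Set.rangeFactorization, Subtype.ext_iff]
  have hcov : IsCoveringMapOn (Set.rangeFactorization T.s) Set.univ :=
    hT.isClosedMap.isCoveringMapOn_of_isLocalHomeomorphOn
      (fun y _ => by rw [hfib]; exact finite_fiber hT y)
      (hloc.isLocalHomeomorphOn.mono fun _ _ => trivial)
  rw [continuousOn_iff_continuous_domRestrict, continuous_iff_continuousAt]
  intro y
  obtain ⟨-, U, hyU, hU, -, H, hH⟩ := hcov y trivial
  have hfin : Finite (Set.rangeFactorization T.s ⁻¹' {y}) := by
    rw [hfib]; exact finite_fiber hT y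
  have := Fintype.ofFinite (Set.rangeFactorization T.s ⁻¹' {y})
  refine ContinuousOn.continuousAt (s := U) ?_ (hU.mem_nhds hyU)
  rw [continuousOn_iff_continuous_domRestrict]
  have key : ∀ u : U, T.fiberSum h ((u : Set.range T.s) : X)
      = ∑ i : (Set.rangeFactorization T.s ⁻¹' {y}), h (H.symm (u, i)) := by
    intro u
    have hu : ∀ i, T.s (H.symm (u, i)) = ((u : Set.range T.s) : X) := fun i => by
      have := hH (H.symm (u, i))
      rw [Homeomorph.apply_symm_apply] at this
      exact congrArg Subtype.val this.symm
    rw [← finsum_eq_sum_of_fintype]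
    refine (finsum_eq_of_bijective (g := fun z : T.s ⁻¹' {((u : Set.range T.s) : X)} => h z)
      (fun i => (⟨H.symm (u, i), hu i⟩ : T.s ⁻¹' {((u : Set.range T.s) : X)}))
      ⟨?_, ?_⟩ fun i => rfl).symm
    · intro i j hij
      have h1 : H.symm (u, i) = H.symm (u, j) := by
        have := congrArg Subtype.val hij
        exact Subtype.ext this
      exact (Prod.ext_iff.1 (H.symm.injective h1)).2
    · rintro ⟨z, hz⟩
      have hzu : Set.rangeFactorization T.s z = u := Subtype.ext hz
      have hzU : z ∈ Set.rangeFactorization T.s ⁻¹' U := by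
        rw [Set.mem_preimage, hzu]; exact u.2
      refine ⟨(H ⟨z, hzU⟩).2, Subtype.ext ?_⟩
      have h1 : (H ⟨z, hzU⟩).1 = u := Subtype.ext ((hH ⟨z, hzU⟩).trans hzu)
      have h2 : (u, (H ⟨z, hzU⟩).2) = H ⟨z, hzU⟩ := by rw [← h1]
      change ((H.symm (u, (H ⟨z, hzU⟩).2) : _) : T.Z) = z
      rw [h2, Homeomorph.symm_apply_apply]
  have hc : Continuous fun u : U =>
      ∑ i : (Set.rangeFactorization T.s ⁻¹' {y}), h (H.symm (u, i)) := by
    fun_prop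
  refine hc.congr fun u => ?_
  rw [← key u]
  rfl

theorem fiberSum_eq_sum {T : TopologicalCorrespondence Y X} (hT : T.RightProper) (h : T.Z → ℂ)
    (x : X) : T.fiberSum h x = ∑ z ∈ (finite_fiber hT x).toFinset, h z := by
  have h1 : T.fiberSum h x = ∑ᶠ z ∈ T.s ⁻¹' {x}, h z := by
    rw [← finsum_set_coe_eq_finsum_mem (T.s ⁻¹' {x})]
    rfl
  rw [h1, finsum_mem_eq_finite_toFinset_sum]

variable [T2Space X]

/-- A sum of a continuous function over the fibres is in `C₀(X)` if it is dominated by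
an element of `C₀(X)` that vanishes off the image of `s`. -/
noncomputable def fiberSumC0 {T : TopologicalCorrespondence Y X} (hT : T.RightProper) {h : T.Z → ℂ}
    (hh : Continuous h) (hg : ∃ g : C₀(X, ℂ), (∀ x ∉ Set.range T.s, g x = 0) ∧
      ∀ x, ‖T.fiberSum h x‖ ≤ ‖g x‖) : C₀(X, ℂ) :=
  C0.mk (Set.range T.s) T.isOpen_range (T.fiberSum h) (continuousOn_fiberSum hT hh) fun ε hε => by
    obtain ⟨g, hg0, hg⟩ := hg
    refine ⟨_, C0.isCompact_le_norm g hε, fun x hx => ?_, fun x hx =>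
      (hg x).trans_lt (not_le.1 hx)⟩
    by_contra hxr
    have hx' : ε ≤ ‖g x‖ := hx
    rw [hg0 x hxr, norm_zero] at hx'
    linarith

end TopologicalCorrespondence

/-- A twisted topological correspondence from `Y` to `X`: a topological correspondence
`(Z, r, s)` together with a Hermitian line bundle `L` over `Z`, that is, a complex line bundle with
an inner product on each of the fibres which is continuous on the total space of `L ⊕ L`. -/
structure TwistedTopologicalCorrespondence (Y : Type*) (X : Type*) [TopologicalSpace Y]
    [TopologicalSpace X] extends TopologicalCorrespondence Y X where
  L : Z → Type*
  [normedAddCommGroupL : ∀ z, NormedAddCommGroup (L z)]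
  [innerProductSpaceL : ∀ z, InnerProductSpace ℂ (L z)]
  [topologicalSpaceL : TopologicalSpace (TotalSpace ℂ L)]
  [fiberBundleL : FiberBundle ℂ L]
  [vectorBundleL : VectorBundle ℂ ℂ L]
  continuous_metric :
    Continuous fun p : TotalSpace (ℂ × ℂ) (L ×ᵇ L) => inner ℂ p.snd.1 p.snd.2

namespace TwistedTopologicalCorrespondence

attribute [instance] normedAddCommGroupL innerProductSpaceL topologicalSpaceL fiberBundleL
  vectorBundleL

section Sections
variable {Y X : Type*} [TopologicalSpace Y] [TopologicalSpace X]

/-- Both the range map, and the source map onto its image, are proper. -/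
def IsProper (P : TwistedTopologicalCorrespondence Y X) : Prop :=
  P.toTopologicalCorrespondence.IsProper

/-- Two twisted correspondences are locally conjugate if the underlying topological
correspondences are. -/
def LocallyConjugate (P : TwistedTopologicalCorrespondence Y X)
    (P' : TwistedTopologicalCorrespondence Y X) : Prop :=
  P.toTopologicalCorrespondence.LocallyConjugate P'.toTopologicalCorrespondence

/-- Continuity of a section of the line bundle. -/
def IsContinuousSection (P : TwistedTopologicalCorrespondence Y X) (ξ : ∀ z, P.L z) : Prop :=
  Continuous fun z => (⟨z, ξ z⟩ : TotalSpace ℂ P.L)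

variable {P : TwistedTopologicalCorrespondence Y X}

theorem isContinuousSection_iff (ξ : ∀ z, P.L z) : P.IsContinuousSection ξ ↔
    ∀ z, ContinuousAt (fun z' => (trivializationAt ℂ P.L z ⟨z', ξ z'⟩).2) z := by
  rw [IsContinuousSection, continuous_iff_continuousAt]
  exact forall_congr' fun z => FiberBundle.continuousAt_section ℂ z

theorem continuousAt_inner {ξ η : ∀ z, P.L z} {z : P.Z}
    (hξ : ContinuousAt (fun z => (⟨z, ξ z⟩ : TotalSpace ℂ P.L)) z)
    (hη : ContinuousAt (fun z => (⟨z, η z⟩ : TotalSpace ℂ P.L)) z) :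
    ContinuousAt (fun z => inner ℂ (ξ z) (η z)) z := by
  have h : ContinuousAt
      (fun z => (⟨z, (ξ z, η z)⟩ : TotalSpace (ℂ × ℂ) (P.L ×ᵇ P.L))) z := by
    rw [(FiberBundle.Prod.isInducing_diag ℂ P.L ℂ P.L).continuousAt_iff]
    exact hξ.prodMk hη
  exact ContinuousAt.comp (g := fun p : TotalSpace (ℂ × ℂ) (P.L ×ᵇ P.L) =>
    inner ℂ p.snd.1 p.snd.2) P.continuous_metric.continuousAt h

theorem IsContinuousSection.inner {ξ η : ∀ z, P.L z} (hξ : P.IsContinuousSection ξ)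
    (hη : P.IsContinuousSection η) : Continuous fun z => inner ℂ (ξ z) (η z) :=
  continuous_iff_continuousAt.2 fun _ => continuousAt_inner hξ.continuousAt hη.continuousAt

theorem eventually_mem_baseSet (z : P.Z) : ∀ᶠ z' in 𝓝 z,
    z' ∈ (trivializationAt ℂ P.L z).baseSet :=
  (trivializationAt ℂ P.L z).open_baseSet.mem_nhds (FiberBundle.mem_baseSet_trivializationAt' z)

theorem isContinuousSection_zero : P.IsContinuousSection fun _ => 0 := by
  rw [isContinuousSection_iff]
  intro z
  refine (continuousAt_const (y := (0 : ℂ))).congr ?_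
  filter_upwards [eventually_mem_baseSet z] with z' hz'
  exact (((trivializationAt ℂ P.L z).linear ℂ hz').map_zero).symm

theorem IsContinuousSection.add {ξ η : ∀ z, P.L z} (hξ : P.IsContinuousSection ξ)
    (hη : P.IsContinuousSection η) : P.IsContinuousSection fun z => ξ z + η z := by
  rw [isContinuousSection_iff] at hξ hη ⊢
  intro z
  refine ((hξ z).add (hη z)).congr ?_
  filter_upwards [eventually_mem_baseSet z] with z' hz'
  exact (((trivializationAt ℂ P.L z).linear ℂ hz').map_add (ξ z') (η z')).symm

theorem IsContinuousSection.smul {ξ : ∀ z, P.L z} (hξ : P.IsContinuousSection ξ) {f : P.Z → ℂ}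
    (hf : Continuous f) : P.IsContinuousSection fun z => f z • ξ z := by
  rw [isContinuousSection_iff] at hξ ⊢
  intro z
  refine (hf.continuousAt.mul (hξ z)).congr ?_
  filter_upwards [eventually_mem_baseSet z] with z' hz'
  exact (((trivializationAt ℂ P.L z).linear ℂ hz').map_smul (f z') (ξ z')).symm

/-- A uniform limit of continuous sections is continuous. -/
theorem isContinuousSection_of_approx {ξ : ∀ z, P.L z}
    (h : ∀ ε : ℝ, 0 < ε → ∃ η, P.IsContinuousSection η ∧ ∀ z, ‖ξ z - η z‖ ≤ ε) :
    P.IsContinuousSection ξ := by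
  rw [isContinuousSection_iff]
  intro z
  set e := trivializationAt ℂ P.L z with he
  let u : ∀ z, P.L z := fun z' => e.symm z' 1
  have hu1 : ∀ z' ∈ e.baseSet, (e ⟨z', u z'⟩).2 = 1 := fun z' hz' => by
    rw [e.apply_mk_symm hz']
  have hu : ContinuousAt (fun z => (⟨z, u z⟩ : TotalSpace ℂ P.L)) z := by
    refine (FiberBundle.continuousAt_section ℂ z).2 ?_
    refine (continuousAt_const (y := (1 : ℂ))).congr ?_
    filter_upwards [eventually_mem_baseSet z] with z' hz'
    exact (hu1 z' hz').symm
  have hun : ContinuousAt (fun z => ‖u z‖) z := by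
    have h1 : ContinuousAt (fun z => Real.sqrt (inner ℂ (u z) (u z)).re) z :=
      (Real.continuous_sqrt.comp Complex.continuous_re).continuousAt.comp
        (continuousAt_inner hu hu)
    refine h1.congr (Eventually.of_forall fun z' => ?_)
    exact (norm_eq_sqrt_re_inner (𝕜 := ℂ) (u z')).symm
  have hu0 : 0 < ‖u z‖ := by
    rw [norm_pos_iff]
    intro h0
    have h1 := hu1 z (FiberBundle.mem_baseSet_trivializationAt' z)
    rw [h0] at h1
    have h2 : (e ⟨z, (0 : P.L z)⟩).2 = 0 :=
      (e.linear ℂ (FiberBundle.mem_baseSet_trivializationAt' z)).map_zero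
    rw [h2] at h1
    exact zero_ne_one h1
  refine continuousAt_of_locally_uniform_approx_of_continuousAt fun V hV => ?_
  obtain ⟨ε, hε, hεV⟩ := Metric.mem_uniformity_dist.1 hV
  obtain ⟨η, hη, hξη⟩ := h (ε / 2 * (‖u z‖ / 2)) (by positivity)
  refine ⟨{z' | z' ∈ e.baseSet ∧ ‖u z‖ / 2 < ‖u z'‖}, ?_, _,
    (isContinuousSection_iff η).1 hη z, ?_⟩
  · exact (eventually_mem_baseSet z).and (hun.eventually (lt_mem_nhds (half_lt_self hu0)))
  · rintro z' ⟨hz', hz'u⟩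
    apply hεV
    have hlin := e.linear ℂ hz'
    set c : ℂ := (e ⟨z', ξ z' - η z'⟩).2 with hc
    have h1 : (e ⟨z', ξ z'⟩).2 - (e ⟨z', η z'⟩).2 = c := (hlin.map_sub _ _).symm
    have h2 : c • u z' = ξ z' - η z' := by
      have h3 : (e ⟨z', c • u z'⟩).2 = (e ⟨z', ξ z' - η z'⟩).2 := by
        refine (hlin.map_smul c (u z')).trans ?_
        rw [hu1 z' hz', smul_eq_mul, mul_one]
      have h4 : (e.linearEquivAt ℂ z' hz') (c • u z') = (e.linearEquivAt ℂ z' hz') (ξ z' - η z') :=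
        h3
      exact (e.linearEquivAt ℂ z' hz').injective h4
    have h3 : ‖c‖ * ‖u z'‖ ≤ ε / 2 * (‖u z‖ / 2) := by
      rw [← norm_smul, h2]; exact hξη z'
    rw [dist_eq_norm, h1]
    by_contra hlt
    have h4 : ε ≤ ‖c‖ := not_lt.1 hlt
    have h5 : ε * (‖u z‖ / 2) ≤ ‖c‖ * ‖u z'‖ := by gcongr
    nlinarith [mul_pos hε hu0]

/-- The fibres of the line bundle are complete. -/
theorem completeSpace_fiber (z : P.Z) : CompleteSpace (P.L z) := by
  have : FiniteDimensional ℂ (P.L z) :=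
    ((trivializationAt ℂ P.L z).linearEquivAt ℂ z
      (FiberBundle.mem_baseSet_trivializationAt' z)).symm.finiteDimensional
  exact FiniteDimensional.complete ℂ (P.L z)

end Sections

section Module
variable {Y X : Type*} [TopologicalSpace Y] [TopologicalSpace X]

/-- The function `⟨ξ, η⟩(x) = ∑_{s(z) = x} ⟨ξ(z), η(z)⟩` on `X`. -/
noncomputable def sectionInner (P : TwistedTopologicalCorrespondence Y X) (ξ η : ∀ z, P.L z)
    (x : X) : ℂ :=
  P.fiberSum (fun z => inner ℂ (ξ z) (η z)) x

/-- The sections `ξ` of the line bundle which are continuous, and for which `⟨ξ, ξ⟩` is in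
`C₀(X)`. If the fibres of `s` have bounded cardinality then these are the continuous sections
vanishing at infinity on `Z`; if not, then `⟨ξ, ξ⟩` need not be in `C₀(X)` for the latter. -/
def IsC0Section (P : TwistedTopologicalCorrespondence Y X) (ξ : ∀ z, P.L z) : Prop :=
  P.IsContinuousSection ξ ∧ ∃ g : C₀(X, ℂ), ∀ x, g x = P.sectionInner ξ ξ x

variable {P : TwistedTopologicalCorrespondence Y X}

theorem sectionInner_self (hP : P.RightProper) (ξ : ∀ z, P.L z) (x : X) :
    P.sectionInner ξ ξ x
      = ((∑ z ∈ (TopologicalCorrespondence.finite_fiber hP x).toFinset, ‖ξ z‖ ^ 2 : ℝ) : ℂ) := by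
  rw [sectionInner, TopologicalCorrespondence.fiberSum_eq_sum hP, Complex.ofReal_sum]
  refine Finset.sum_congr rfl fun z _ => ?_
  rw [inner_self_eq_norm_sq_to_K]
  simp

theorem exists_dominating (hP : P.RightProper) {ξ η : ∀ z, P.L z} (hξ : P.IsC0Section ξ)
    (hη : P.IsC0Section η) {h : P.Z → ℂ} {c : ℝ}
    (hh : ∀ z, ‖h z‖ ≤ c * (‖ξ z‖ ^ 2 + ‖η z‖ ^ 2)) :
    ∃ g : C₀(X, ℂ), (∀ x ∉ Set.range P.s, g x = 0) ∧ ∀ x, ‖P.fiberSum h x‖ ≤ ‖g x‖ := by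
  obtain ⟨-, g₁, hg₁⟩ := hξ
  obtain ⟨-, g₂, hg₂⟩ := hη
  refine ⟨(c : ℂ) • (g₁ + g₂), fun x hx => ?_, fun x => ?_⟩
  · rw [ZeroAtInftyContinuousMap.smul_apply, ZeroAtInftyContinuousMap.add_apply, hg₁, hg₂,
      sectionInner, sectionInner, P.fiberSum_of_notMem _ hx, P.fiberSum_of_notMem _ hx, add_zero,
      smul_zero]
  · rw [ZeroAtInftyContinuousMap.smul_apply, ZeroAtInftyContinuousMap.add_apply, hg₁, hg₂,
      sectionInner_self hP, sectionInner_self hP, TopologicalCorrespondence.fiberSum_eq_sum hP,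
      smul_eq_mul, ← Complex.ofReal_add, ← Complex.ofReal_mul, Complex.norm_real,
      ← Finset.sum_add_distrib, Finset.mul_sum]
    exact (norm_sum_le _ _).trans ((Finset.sum_le_sum fun z _ => hh z).trans (le_abs_self _))

theorem isC0Section_zero : P.IsC0Section fun _ => 0 :=
  ⟨isContinuousSection_zero, 0, fun x => by simp [sectionInner, TopologicalCorrespondence.fiberSum]⟩

variable [T2Space X]

theorem isC0Section_of_le (hP : P.RightProper) {ξ η ζ : ∀ z, P.L z} (hξ : P.IsC0Section ξ)
    (hη : P.IsC0Section η) (hζ : P.IsContinuousSection ζ) {c : ℝ}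
    (h : ∀ z, ‖ζ z‖ ^ 2 ≤ c * (‖ξ z‖ ^ 2 + ‖η z‖ ^ 2)) : P.IsC0Section ζ := by
  refine ⟨hζ, TopologicalCorrespondence.fiberSumC0 hP (hζ.inner hζ)
    (exists_dominating hP hξ hη (c := c) fun z => ?_), fun x => rfl⟩
  rw [inner_self_eq_norm_sq_to_K, norm_pow, RCLike.norm_ofReal, abs_norm]
  exact h z

theorem isC0Section_add (hP : P.RightProper) {ξ η : ∀ z, P.L z} (hξ : P.IsC0Section ξ)
    (hη : P.IsC0Section η) : P.IsC0Section fun z => ξ z + η z := by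
  refine isC0Section_of_le hP hξ hη (hξ.1.add hη.1) (c := 2) fun z => ?_
  have := norm_add_le (ξ z) (η z)
  nlinarith [sq_nonneg (‖ξ z‖ - ‖η z‖), norm_nonneg (ξ z + η z)]

theorem isC0Section_smul (hP : P.RightProper) {ξ : ∀ z, P.L z} (hξ : P.IsC0Section ξ)
    {f : P.Z → ℂ} (hf : Continuous f) {c : ℝ} (hc : ∀ z, ‖f z‖ ≤ c) :
    P.IsC0Section fun z => f z • ξ z := by
  refine isC0Section_of_le hP hξ hξ (hξ.1.smul hf) (c := c ^ 2) fun z => ?_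
  rw [norm_smul, mul_pow]
  have h1 : ‖f z‖ ^ 2 ≤ c ^ 2 := pow_le_pow_left₀ (norm_nonneg _) (hc z) 2
  nlinarith [sq_nonneg ‖ξ z‖, mul_nonneg (sq_nonneg c) (sq_nonneg ‖ξ z‖)]

/-- The vector space of `C₀`-sections of the line bundle. -/
def sectionSubmodule (P : TwistedTopologicalCorrespondence Y X) (hP : P.RightProper) :
    Submodule ℂ (∀ z, P.L z) where
  carrier := {ξ | P.IsC0Section ξ}
  add_mem' hξ hη := isC0Section_add hP hξ hη
  zero_mem' := isC0Section_zero
  smul_mem' c _ hξ := isC0Section_smul hP hξ (continuous_const (y := c)) fun _ => le_rfl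

/-- The underlying space of the Hilbert module `Γ₀(Z, s, L)`. -/
def Sections (P : TwistedTopologicalCorrespondence Y X) (hP : P.RightProper) : Type _ :=
  P.sectionSubmodule hP

namespace Sections
variable {hP : P.RightProper}

noncomputable instance instAddCommGroup : AddCommGroup (P.Sections hP) :=
  inferInstanceAs (AddCommGroup (P.sectionSubmodule hP))

noncomputable instance instModule : Module ℂ (P.Sections hP) :=
  inferInstanceAs (Module ℂ (P.sectionSubmodule hP))

instance instCoeFun : CoeFun (P.Sections hP) fun _ => ∀ z, P.L z := ⟨fun ξ => Subtype.val ξ⟩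

theorem isC0Section (ξ : P.Sections hP) : P.IsC0Section ξ := Subtype.property ξ

theorem ext {ξ η : P.Sections hP} (h : ∀ z, ξ z = η z) : ξ = η := Subtype.ext (funext h)

theorem add_apply (ξ η : P.Sections hP) (z : P.Z) : (ξ + η) z = ξ z + η z := rfl
theorem sub_apply (ξ η : P.Sections hP) (z : P.Z) : (ξ - η) z = ξ z - η z := rfl
theorem smul_apply (c : ℂ) (ξ : P.Sections hP) (z : P.Z) : (c • ξ) z = c • ξ z := rfl
theorem zero_apply (z : P.Z) : (0 : P.Sections hP) z = 0 := rfl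

/-- The section `z ↦ f(z) ξ(z)`, for a bounded continuous function `f`. -/
def mulFun (f : P.Z → ℂ) (hf : Continuous f) (hb : ∃ c : ℝ, ∀ z, ‖f z‖ ≤ c)
    (ξ : P.Sections hP) : P.Sections hP :=
  ⟨fun z => f z • ξ z, hb.elim fun _ hc => isC0Section_smul hP ξ.isC0Section hf hc⟩

/-- The right action `(ξ f)(z) = ξ(z) f(s(z))` of `C₀(X)`. -/
noncomputable instance instSMul : SMul C₀(X, ℂ) (P.Sections hP) where
  smul f := mulFun (fun z => f (P.s z))
    ((map_continuous f).comp P.isLocalHomeomorph_s.continuous)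
    ⟨‖f‖, fun z => C0.norm_apply_le f (P.s z)⟩

theorem c0_smul_apply (f : C₀(X, ℂ)) (ξ : P.Sections hP) (z : P.Z) :
    (f • ξ) z = f (P.s z) • ξ z := rfl

/-- The `C₀(X)`-valued inner product `⟨ξ, η⟩(x) = ∑_{s(z) = x} ⟨ξ(z), η(z)⟩`. -/
noncomputable instance instInner : Inner C₀(X, ℂ) (P.Sections hP) where
  inner ξ η := TopologicalCorrespondence.fiberSumC0 hP
    (ξ.isC0Section.1.inner η.isC0Section.1)
    (exists_dominating hP ξ.isC0Section η.isC0Section (c := 1) fun z => by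
      have := norm_inner_le_norm (𝕜 := ℂ) (ξ z) (η z)
      nlinarith [sq_nonneg (‖ξ z‖ - ‖η z‖), sq_nonneg ‖ξ z‖, sq_nonneg ‖η z‖])

theorem inner_apply (ξ η : P.Sections hP) (x : X) :
    (inner C₀(X, ℂ) ξ η) x = P.sectionInner ξ η x := rfl

theorem inner_apply_eq_sum (ξ η : P.Sections hP) (x : X) : (inner C₀(X, ℂ) ξ η) x
    = ∑ z ∈ (TopologicalCorrespondence.finite_fiber hP x).toFinset, inner ℂ (ξ z) (η z) :=
  TopologicalCorrespondence.fiberSum_eq_sum hP (fun z => inner ℂ (ξ z) (η z)) x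

theorem inner_self_apply (ξ : P.Sections hP) (x : X) : (inner C₀(X, ℂ) ξ ξ) x
    = ((∑ z ∈ (TopologicalCorrespondence.finite_fiber hP x).toFinset, ‖ξ z‖ ^ 2 : ℝ) : ℂ) :=
  sectionInner_self hP ξ x

theorem norm_sq_le_norm_inner (ξ : P.Sections hP) (z : P.Z) :
    ‖ξ z‖ ^ 2 ≤ ‖inner C₀(X, ℂ) ξ ξ‖ := by
  refine le_trans ?_ (C0.norm_apply_le _ (P.s z))
  rw [inner_self_apply, Complex.norm_real]
  refine le_trans ?_ (le_abs_self _)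
  refine Finset.single_le_sum (f := fun z => ‖ξ z‖ ^ 2) (fun _ _ => sq_nonneg _) ?_
  simp

noncomputable instance instNorm : Norm (P.Sections hP) :=
  CStarModule.norm C₀(X, ℂ)

noncomputable instance instCStarModule : CStarModule C₀(X, ℂ) (P.Sections hP) where
  inner_add_right {ξ η ζ} := by
    ext x
    simp only [ZeroAtInftyContinuousMap.add_apply, inner_apply_eq_sum, add_apply, inner_add_right,
      Finset.sum_add_distrib]
  inner_self_nonneg {ξ} x := by
    change (0 : C₀(X, ℂ)) x ≤ (inner C₀(X, ℂ) ξ ξ) x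
    rw [inner_self_apply, ZeroAtInftyContinuousMap.zero_apply]
    exact_mod_cast Finset.sum_nonneg fun z _ => sq_nonneg ‖ξ z‖
  inner_self {ξ} := by
    refine ⟨fun h => ext fun z => ?_, ?_⟩
    · have := norm_sq_le_norm_inner ξ z
      rw [h, norm_zero] at this
      have h0 : ‖ξ z‖ = 0 := by nlinarith [norm_nonneg (ξ z)]
      exact norm_eq_zero.1 h0
    · rintro rfl
      ext x
      rw [inner_self_apply]
      simp [zero_apply]
  inner_op_smul_right {f ξ η} := by
    ext x
    rw [ZeroAtInftyContinuousMap.mul_apply, inner_apply_eq_sum, inner_apply_eq_sum, Finset.mul_sum]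
    refine Finset.sum_congr rfl fun z hz => ?_
    have hz' : P.s z = x := by simpa using hz
    rw [c0_smul_apply, inner_smul_right, hz']
  inner_smul_right_complex {c ξ η} := by
    ext x
    rw [ZeroAtInftyContinuousMap.smul_apply, inner_apply_eq_sum, inner_apply_eq_sum, smul_eq_mul,
      Finset.mul_sum]
    refine Finset.sum_congr rfl fun z hz => ?_
    rw [smul_apply, inner_smul_right]
  star_inner ξ η := by
    ext x
    rw [ZeroAtInftyContinuousMap.star_apply, inner_apply_eq_sum, inner_apply_eq_sum, star_sum]
    refine Finset.sum_congr rfl fun z hz => ?_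
    exact inner_conj_symm (η z) (ξ z)
  norm_eq_sqrt_norm_inner_self ξ := rfl

noncomputable instance instNormedAddCommGroup : NormedAddCommGroup (P.Sections hP) :=
  CStarModule.normedAddCommGroup C₀(X, ℂ)

noncomputable instance instNormedSpace : NormedSpace ℂ (P.Sections hP) :=
  .ofCore (CStarModule.normedSpaceCore C₀(X, ℂ))

theorem norm_apply_le (ξ : P.Sections hP) (z : P.Z) : ‖ξ z‖ ≤ ‖ξ‖ :=
  Real.le_sqrt_of_sq_le (norm_sq_le_norm_inner ξ z)

theorem norm_le_iff (ξ : P.Sections hP) {c : ℝ} (hc : 0 ≤ c) : ‖ξ‖ ≤ c ↔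
    ∀ x, ∑ z ∈ (TopologicalCorrespondence.finite_fiber hP x).toFinset, ‖ξ z‖ ^ 2 ≤ c ^ 2 := by
  change √‖inner C₀(X, ℂ) ξ ξ‖ ≤ c ↔ _
  rw [Real.sqrt_le_left hc, C0.norm_le_iff _ (sq_nonneg c)]
  refine forall_congr' fun x => ?_
  rw [inner_self_apply, Complex.norm_real,
    Real.norm_of_nonneg (Finset.sum_nonneg fun z _ => sq_nonneg _)]

instance instCompleteSpace : CompleteSpace (P.Sections hP) := by
  refine Metric.complete_of_cauchySeq_tendsto fun ξ hξ => ?_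
  have hcau : ∀ z, CauchySeq fun n => ξ n z := fun z => by
    rw [Metric.cauchySeq_iff] at hξ ⊢
    intro ε hε
    obtain ⟨N, hN⟩ := hξ ε hε
    refine ⟨N, fun m hm n hn => ?_⟩
    have := hN m hm n hn
    rw [dist_eq_norm] at this ⊢
    exact (norm_apply_le (ξ m - ξ n) z).trans_lt this
  have hlim : ∀ z, ∃ l, Tendsto (fun n => ξ n z) atTop (𝓝 l) := fun z => by
    have := completeSpace_fiber (P := P) z
    exact cauchySeq_tendsto_of_complete (hcau z)
  choose l hl using hlim
  have hunif : ∀ ε : ℝ, 0 < ε → ∃ N, ∀ n ≥ N, ∀ x,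
      ∑ z ∈ (TopologicalCorrespondence.finite_fiber hP x).toFinset, ‖l z - ξ n z‖ ^ 2 ≤ ε ^ 2 := by
    intro ε hε
    obtain ⟨N, hN⟩ := Metric.cauchySeq_iff.1 hξ ε hε
    refine ⟨N, fun n hn x => ?_⟩
    have ht : Tendsto (fun m => ∑ z ∈ (TopologicalCorrespondence.finite_fiber hP x).toFinset,
        ‖ξ m z - ξ n z‖ ^ 2) atTop (𝓝 (∑ z ∈ (TopologicalCorrespondence.finite_fiber hP x).toFinset,
        ‖l z - ξ n z‖ ^ 2)) :=
      tendsto_finsetSum _ fun z _ => (((hl z).sub_const (ξ n z)).norm.pow 2)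
    refine le_of_tendsto ht ?_
    filter_upwards [eventually_ge_atTop N] with m hm
    have h1 := (hN m hm n hn).le
    rw [dist_eq_norm] at h1
    exact (norm_le_iff (ξ m - ξ n) hε.le).1 h1 x
  have hpt : ∀ ε : ℝ, 0 < ε → ∃ N, ∀ n ≥ N, ∀ z, ‖l z - ξ n z‖ ≤ ε := by
    intro ε hε
    obtain ⟨N, hN⟩ := hunif ε hε
    refine ⟨N, fun n hn z => ?_⟩
    refine le_of_sq_le_sq ?_ hε.le
    refine le_trans ?_ (hN n hn (P.s z))
    exact Finset.single_le_sum (f := fun z => ‖l z - ξ n z‖ ^ 2) (fun _ _ => sq_nonneg _) (by simp)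
  have hlc : P.IsContinuousSection l := isContinuousSection_of_approx fun ε hε => by
    obtain ⟨N, hN⟩ := hpt ε hε
    exact ⟨ξ N, (ξ N).isC0Section.1, hN N le_rfl⟩
  have hl0 : P.IsC0Section l := by
    refine ⟨hlc, C0.mk (Set.range P.s) P.isOpen_range (P.sectionInner l l)
      (TopologicalCorrespondence.continuousOn_fiberSum hP (hlc.inner hlc)) fun ε hε => ?_,
      fun x => rfl⟩
    obtain ⟨N, hN⟩ := hunif (Real.sqrt (ε / 8)) (by positivity)
    refine ⟨_, C0.isCompact_le_norm (inner C₀(X, ℂ) (ξ N) (ξ N)) (ε := ε / 4) (by positivity),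
      fun x hx => ?_, fun x hx => ?_⟩
    · by_contra hxr
      have hx' : ε / 4 ≤ ‖(inner C₀(X, ℂ) (ξ N) (ξ N)) x‖ := hx
      rw [inner_apply, sectionInner, P.fiberSum_of_notMem _ hxr, norm_zero] at hx'
      linarith
    · have h1 : ‖(inner C₀(X, ℂ) (ξ N) (ξ N)) x‖ < ε / 4 := not_le.1 hx
      have h2 := hN N le_rfl x
      rw [Real.sq_sqrt (by positivity)] at h2
      rw [inner_self_apply, Complex.norm_real,
        Real.norm_of_nonneg (Finset.sum_nonneg fun z _ => sq_nonneg _)] at h1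
      rw [sectionInner_self hP, Complex.norm_real,
        Real.norm_of_nonneg (Finset.sum_nonneg fun z _ => sq_nonneg _)]
      have h3 : ∑ z ∈ (TopologicalCorrespondence.finite_fiber hP x).toFinset, ‖l z‖ ^ 2 ≤
          ∑ z ∈ (TopologicalCorrespondence.finite_fiber hP x).toFinset,
            (2 * ‖ξ N z‖ ^ 2 + 2 * ‖l z - ξ N z‖ ^ 2) := by
        refine Finset.sum_le_sum fun z _ => ?_
        have h4 : ‖l z‖ ≤ ‖ξ N z‖ + ‖l z - ξ N z‖ := by
          simpa using norm_add_le (ξ N z) (l z - ξ N z)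
        nlinarith [sq_nonneg (‖ξ N z‖ - ‖l z - ξ N z‖), norm_nonneg (l z)]
      rw [Finset.sum_add_distrib, ← Finset.mul_sum, ← Finset.mul_sum] at h3
      linarith
  let l' : P.Sections hP := ⟨l, hl0⟩
  refine ⟨l', ?_⟩
  rw [Metric.tendsto_atTop]
  intro ε hε
  obtain ⟨N, hN⟩ := hunif (ε / 2) (by positivity)
  refine ⟨N, fun n hn => ?_⟩
  rw [dist_comm, dist_eq_norm]
  exact lt_of_le_of_lt ((norm_le_iff (l' - ξ n) (by positivity)).2 fun x => hN n hn x)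
    (half_lt_self hε)

end Sections

/-- The C*-correspondence `Γ₀(Z, r, s, L)` from `C₀(Y)` to `C₀(X)`, with left action
`(φ(f) ξ)(z) = f(r(z)) ξ(z)`. -/
noncomputable def sectionCorrespondence (P : TwistedTopologicalCorrespondence Y X)
    (hP : P.RightProper) : CStarCorrespondence Y X where
  Carrier := P.Sections hP
  leftAction :=
    { toFun := fun f => LinearMap.mkContinuous
        { toFun := Sections.mulFun (fun z => f (P.r z)) ((map_continuous f).comp P.continuous_r)
            ⟨‖f‖, fun z => C0.norm_apply_le f (P.r z)⟩
          map_add' := fun ξ η => Sections.ext fun z => smul_add (f (P.r z)) (ξ z) (η z)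
          map_smul' := fun c ξ => Sections.ext fun z => smul_comm (f (P.r z)) c (ξ z) }
        ‖f‖ (fun ξ => by
          rw [Sections.norm_le_iff _ (by positivity)]
          intro x
          have h1 := (Sections.norm_le_iff ξ (norm_nonneg ξ)).1 le_rfl x
          calc _ ≤ ∑ z ∈ (TopologicalCorrespondence.finite_fiber hP x).toFinset,
                ‖f‖ ^ 2 * ‖ξ z‖ ^ 2 := by
                refine Finset.sum_le_sum fun z _ => ?_
                change ‖f (P.r z) • ξ z‖ ^ 2 ≤ _
                rw [norm_smul, mul_pow]
                gcongr
                exact C0.norm_apply_le f (P.r z)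
            _ ≤ (‖f‖ * ‖ξ‖) ^ 2 := by
                rw [← Finset.mul_sum, mul_pow]
                gcongr)
      map_smul' := fun c f => by
        ext ξ; exact Sections.ext fun z => smul_assoc c (f (P.r z)) (ξ z)
      map_zero' := by ext ξ; exact Sections.ext fun z => zero_smul ℂ (ξ z)
      map_add' := fun f g => by
        ext ξ; exact Sections.ext fun z => add_smul (f (P.r z)) (g (P.r z)) (ξ z)
      map_mul' := fun f g => by
        ext ξ; exact Sections.ext fun z => mul_smul (f (P.r z)) (g (P.r z)) (ξ z) }
  inner_leftAction f ξ η := by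
    ext x
    rw [Sections.inner_apply_eq_sum, Sections.inner_apply_eq_sum]
    refine Finset.sum_congr rfl fun z _ => ?_
    change inner ℂ (f (P.r z) • ξ z) (η z) = inner ℂ (ξ z) (star (f (P.r z)) • η z)
    rw [inner_smul_left, inner_smul_right]
    rfl

end Module
end TwistedTopologicalCorrespondence

/-! ### Cutoff functions in `C₀` -/

namespace C0

/-! The inner product of `Γ₀` at `x` is a sum over the fibre `s⁻¹(x)`, so localizing the Hilbert
module at `x` gives the finite-dimensional space `⊕ L_z`, with `z` in that fibre. Its dimension is
the number of points of the fibre, and `C₀(Y)` acts on the summand `L_z` by evaluation at `r(z)`.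
The line bundles therefore cannot obstruct anything, provided they are trivial over small open
subsets of `X`.

That proviso is where closedness enters. Either condition forces `s(Z) = s'(Z')`, so both images are
closed, and `s`, `s'` are then proper as maps into `X`. Hence they are finite coverings over a
neighbourhood of every point of `X` (with empty fibres off the image), and a section that is nonzero
at all points of one fibre is nonzero over a neighbourhood (`exists_section_ne_zero`).

From conjugacy to isomorphism: over a small `U` there are a homeomorphism `φ` and nonvanishing
sections `u`, `u'`. Sending `u/‖u‖` to `u'/‖u'‖` along `φ` is a fibrewise unitary map (`transport`).
It preserves fibre sums and commutes with multiplication by functions pulled back along `s` and `r`.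
Elements of `Γ₀ C₀(U)` are the sections vanishing off `s⁻¹(U)` (`mem_restrictSubmodule_iff`), and
extension by zero keeps them continuous because `⟨ξ,ξ⟩` is unchanged.

From isomorphism to conjugacy: a unitary `T` maps sections vanishing on a fibre to sections
vanishing on the corresponding fibre, so fibres over the same point have equally many points
(`card_fiber_le`). Near `x`, choose sections `ξ_i`, each supported in one sheet of the covering and
nonzero over `x`. The matrix of values of `T ξ_i` at the points of the other fibre is nonsingular,
so its Leibniz expansion provides a bijection `σ` of sheets such that `T ξ_i` is nonzero at the
point over `x` in the sheet `σ(i)`, hence also over nearby points. Compatibility with the left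
action forces `r` and `r'` to agree wherever this value is nonzero (`r_eq_of_evalRestrict_ne_zero`).
Matching sheets by `σ` is the conjugacy. -/

theorem exists_bump {X : Type*} [TopologicalSpace X] [T2Space X] [LocallyCompactSpace X]
    {K V : Set X} (hK : IsCompact K) (hV : IsOpen V) (hKV : K ⊆ V) :
    ∃ f : C₀(X, ℂ), (∀ x ∈ K, f x = 1) ∧ (∀ x ∉ V, f x = 0) ∧
      ∀ x, ∃ t ∈ Set.Icc (0 : ℝ) 1, f x = (t : ℂ) := by
  obtain ⟨f, hf1, hfc, hfV, hf⟩ := exists_continuousMap_one_of_isCompact_subset_isOpen hK hV hKV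
  have h0 : ∀ x ∉ tsupport f, f x = 0 := fun x hx => image_eq_zero_of_notMem_tsupport hx
  refine ⟨⟨⟨fun x => (f x : ℂ), by fun_prop⟩, tendsto_of_compact _ fun ε hε =>
    ⟨tsupport f, hfc, fun x hx => ?_⟩⟩, fun x hx => ?_, fun x hx => ?_, fun x => ⟨f x, hf x, rfl⟩⟩
  · simpa [h0 x hx] using hε
  · have := hf1 hx
    change ((f x : ℝ) : ℂ) = 1
    simp_all
  · change ((f x : ℝ) : ℂ) = 0
    simp [h0 x fun h => hx (hfV h)]

/-- This recovers values of the range map from the left action: the action only shows which `g`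
annihilate a vector. -/
theorem eq_of_forall_apply_eq_zero {Y : Type*} [TopologicalSpace Y] [T2Space Y]
    [LocallyCompactSpace Y] {a b : Y} (h : ∀ g : C₀(Y, ℂ), g a = 0 → g b = 0) : a = b := by
  by_contra hab
  obtain ⟨g, h1, h0, -⟩ := exists_bump (isCompact_singleton (x := b))
    (isOpen_compl_singleton (x := a)) (by simpa using hab)
  have h2 := h g (h0 a (by simp))
  rw [h1 b rfl] at h2
  exact one_ne_zero h2

end C0

/-! ### Local frames and bump sections of the line bundle -/

namespace TwistedTopologicalCorrespondence

section Sections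
variable {Y X : Type*} [TopologicalSpace Y] [TopologicalSpace X]
  {P : TwistedTopologicalCorrespondence Y X}

theorem continuousAt_smul_section {ξ : ∀ z, P.L z} {f : P.Z → ℂ} {z : P.Z}
    (hf : ContinuousAt f z) (hξ : ContinuousAt (fun z => (⟨z, ξ z⟩ : TotalSpace ℂ P.L)) z) :
    ContinuousAt (fun z => (⟨z, f z • ξ z⟩ : TotalSpace ℂ P.L)) z := by
  rw [FiberBundle.continuousAt_section] at hξ ⊢
  refine (hf.mul hξ).congr ?_
  filter_upwards [eventually_mem_baseSet z] with z' hz'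
  exact (((trivializationAt ℂ P.L z).linear ℂ hz').map_smul (f z') (ξ z')).symm

theorem continuousAt_norm_section {ξ : ∀ z, P.L z} {z : P.Z}
    (hξ : ContinuousAt (fun z => (⟨z, ξ z⟩ : TotalSpace ℂ P.L)) z) :
    ContinuousAt (fun z => ‖ξ z‖) z := by
  have h1 : ContinuousAt (fun z => Real.sqrt (inner ℂ (ξ z) (ξ z)).re) z :=
    (Real.continuous_sqrt.comp Complex.continuous_re).continuousAt.comp
      (continuousAt_inner hξ hξ)
  exact h1.congr (Eventually.of_forall fun z' => (norm_eq_sqrt_re_inner (𝕜 := ℂ) (ξ z')).symm)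

theorem IsContinuousSection.norm {ξ : ∀ z, P.L z} (hξ : P.IsContinuousSection ξ) :
    Continuous fun z => ‖ξ z‖ :=
  continuous_iff_continuousAt.2 fun _ => continuousAt_norm_section hξ.continuousAt

theorem finrank_fiber (z : P.Z) : Module.finrank ℂ (P.L z) = 1 := by
  rw [((trivializationAt ℂ P.L z).linearEquivAt ℂ z
    (FiberBundle.mem_baseSet_trivializationAt' z)).finrank_eq, Module.finrank_self]

/-- The fibres are one-dimensional, so that a vector is determined by its inner product with
a nonzero vector. -/
theorem eq_inner_smul {z : P.Z} {u : P.L z} (hu : u ≠ 0) (v : P.L z) :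
    v = (inner ℂ u v / (‖u‖ : ℂ) ^ 2) • u := by
  obtain ⟨c, rfl⟩ := (finrank_eq_one_iff_of_nonzero' u hu).1 (finrank_fiber z) v
  have h : (‖u‖ : ℂ) ≠ 0 := by simpa using hu
  rw [inner_smul_right, inner_self_eq_norm_sq_to_K]
  congr 1
  simp [h]

/-- A continuous section, which is nonzero at a given point and vanishes off a compact subset of a
given neighbourhood. -/
theorem exists_bump_section (z₀ : P.Z) {W : Set P.Z} (hW : IsOpen W) (hz₀ : z₀ ∈ W) :
    ∃ ξ : ∀ z, P.L z, P.IsContinuousSection ξ ∧ ξ z₀ ≠ 0 ∧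
      ∃ K, IsCompact K ∧ K ⊆ W ∧ ∀ z ∉ K, ξ z = 0 := by
  set e := trivializationAt ℂ P.L z₀ with he
  have hze : z₀ ∈ e.baseSet := FiberBundle.mem_baseSet_trivializationAt' z₀
  obtain ⟨f, hf1, hfc, hfV, hf⟩ := exists_continuousMap_one_of_isCompact_subset_isOpen
    (isCompact_singleton (x := z₀)) (hW.inter e.open_baseSet) (by simpa using ⟨hz₀, hze⟩)
  have h0 : ∀ z ∉ tsupport f, f z = 0 := fun x hx => image_eq_zero_of_notMem_tsupport hx
  refine ⟨fun z => (f z : ℂ) • e.symm z 1, ?_, ?_, tsupport f, hfc,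
    hfV.trans Set.inter_subset_left, fun z hz => by simp [h0 z hz]⟩
  -- Points of the support of `f` lie in the base set, where the local frame `e.symm z 1` is
  -- continuous; elsewhere the section is locally zero.
  · refine continuous_iff_continuousAt.2 fun z => ?_
    by_cases hz : z ∈ tsupport f
    · refine continuousAt_smul_section (by fun_prop) ?_
      have hzb := (hfV hz).2
      have h1 : ContinuousAt (fun z' => e.toOpenPartialHomeomorph.symm (z', (1 : ℂ))) z := by
        refine ContinuousAt.comp (f := fun z' : P.Z => (z', (1 : ℂ)))
          (g := e.toOpenPartialHomeomorph.symm) ?_ (by fun_prop)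
        exact e.toOpenPartialHomeomorph.continuousAt_symm (e.mem_target.2 hzb)
      refine h1.congr ?_
      filter_upwards [e.open_baseSet.mem_nhds hzb] with z' hz'
      exact (e.mk_symm hz' 1).symm
    · have h1 : ContinuousAt (fun z => (⟨z, 0⟩ : TotalSpace ℂ P.L)) z :=
        isContinuousSection_zero.continuousAt
      refine h1.congr ?_
      filter_upwards [(isClosed_tsupport f).isOpen_compl.mem_nhds hz] with z' hz'
      rw [h0 z' hz', Complex.ofReal_zero, zero_smul]
  · have h1 : f z₀ = 1 := hf1 rfl
    simp only [h1, Complex.ofReal_one, one_smul]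
    intro h2
    have h3 := e.apply_mk_symm hze (1 : ℂ)
    have h4 : (e ⟨z₀, (0 : P.L z₀)⟩).2 = 0 := (e.linear ℂ hze).map_zero
    rw [h2] at h3
    rw [h3] at h4
    exact one_ne_zero h4

/-- A section is continuous at the points where its norm tends to zero. -/
theorem continuousAt_section_of_norm {ξ : ∀ z, P.L z} {z₀ : P.Z} (h0 : ξ z₀ = 0)
    (h : Tendsto (fun z => ‖ξ z‖) (𝓝 z₀) (𝓝 0)) :
    ContinuousAt (fun z => (⟨z, ξ z⟩ : TotalSpace ℂ P.L)) z₀ := by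
  obtain ⟨u, hu, hu0, -⟩ := exists_bump_section (P := P) z₀ isOpen_univ trivial
  have hun := hu.norm
  have hne : ‖u z₀‖ ≠ 0 := by simpa using hu0
  have hev : ∀ᶠ z in 𝓝 z₀, u z ≠ 0 :=
    (hun.continuousAt.eventually_ne hne).mono fun z hz => by simpa using hz
  -- Near `z₀` the section is a scalar multiple of the frame `u`; by Cauchy–Schwarz the numerator of
  -- the coefficient tends to zero.
  have hc : ContinuousAt (fun z => inner ℂ (u z) (ξ z) / (‖u z‖ : ℂ) ^ 2) z₀ := by
    have h1 : Tendsto (fun z => inner ℂ (u z) (ξ z)) (𝓝 z₀) (𝓝 0) := by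
      refine squeeze_zero_norm (fun z => norm_inner_le_norm (𝕜 := ℂ) (u z) (ξ z)) ?_
      simpa using (hun.tendsto z₀).mul h
    have h2 : ContinuousAt (fun z => inner ℂ (u z) (ξ z)) z₀ := by
      rw [ContinuousAt, h0, inner_zero_right]
      exact h1
    exact h2.div (by fun_prop) (by simpa using hu0)
  refine (continuousAt_smul_section hc hu.continuousAt).congr ?_
  filter_upwards [hev] with z hz
  rw [← eq_inner_smul hz]

end Sections

section Module
variable {Y X : Type*} [TopologicalSpace Y] [TopologicalSpace X] [T2Space X]
  {P : TwistedTopologicalCorrespondence Y X} {hP : P.RightProper}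

/-- For a continuous section supported in a compact set `K`, the function `⟨ξ,ξ⟩` vanishes off
`s(K)`, a compact subset of the open image of `s`. Hence it is in `C₀(X)` even if the image is not
closed. -/
theorem Sections.exists_bump (hP : P.RightProper) (z₀ : P.Z) {W : Set P.Z} (hW : IsOpen W)
    (hz₀ : z₀ ∈ W) : ∃ ξ : P.Sections hP, ξ z₀ ≠ 0 ∧ ∀ z ∉ W, ξ z = 0 := by
  obtain ⟨ξ, hξ, h0, K, hK, hKW, hξK⟩ := exists_bump_section (P := P) z₀ hW hz₀
  refine ⟨⟨ξ, hξ, C0.mk (Set.range P.s) P.isOpen_range (P.sectionInner ξ ξ)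
    (TopologicalCorrespondence.continuousOn_fiberSum hP (hξ.inner hξ)) fun ε hε =>
    ⟨P.s '' K, hK.image P.isLocalHomeomorph_s.continuous, Set.image_subset_range _ _,
      fun x hx => ?_⟩, fun _ => rfl⟩, h0, fun z hz => hξK z fun h => hz (hKW h)⟩
  have h1 : P.sectionInner ξ ξ x = 0 := by
    rw [sectionInner_self hP, Finset.sum_eq_zero, Complex.ofReal_zero]
    intro z hz
    have hz' : P.s z = x := by simpa using hz
    rw [hξK z fun h => hx ⟨z, h, hz'⟩]
    simp
  rwa [h1, norm_zero]

theorem Sections.inner_self_apply_eq_zero_iff (ξ : P.Sections hP) (x : X) :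
    (inner C₀(X, ℂ) ξ ξ) x = 0 ↔ ∀ z, P.s z = x → ξ z = 0 := by
  rw [inner_self_apply, Complex.ofReal_eq_zero, Finset.sum_eq_zero_iff_of_nonneg
    fun _ _ => sq_nonneg _]
  simp

end Module
end TwistedTopologicalCorrespondence

/-! ### The submodule `Γ₀ C₀(U)` as a space of sections -/

namespace TwistedTopologicalCorrespondence

section Restrict
variable {Y X : Type*} [TopologicalSpace Y] [TopologicalSpace X] [T2Space X]
  {P : TwistedTopologicalCorrespondence Y X} {hP : P.RightProper} {U : Opens X}

/-- Over each `x` the fibre sum of the difference is `|1 - f(x)|² ⟨ξ,ξ⟩(x)`: either the first factor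
is zero, or it is at most `1` and the second is below `ε²`. -/
theorem Sections.norm_sub_smul_le {f : C₀(X, ℂ)}
    (hf : ∀ x, ∃ t ∈ Set.Icc (0 : ℝ) 1, f x = (t : ℂ)) (ξ : P.Sections hP) {ε : ℝ} (hε : 0 ≤ ε)
    (h : ∀ x, ε ^ 2 ≤ ‖(inner C₀(X, ℂ) ξ ξ) x‖ → f x = 1) : ‖ξ - f • ξ‖ ≤ ε := by
  rw [Sections.norm_le_iff _ hε]
  intro x
  have h1 : ∀ z ∈ (TopologicalCorrespondence.finite_fiber hP x).toFinset,
      (ξ - f • ξ) z = (1 - f x) • ξ z := fun z hz => by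
    have hz' : P.s z = x := by simpa using hz
    rw [Sections.sub_apply, Sections.c0_smul_apply, hz', sub_smul, one_smul]
  rw [Finset.sum_congr rfl fun z hz => by rw [h1 z hz, norm_smul, mul_pow], ← Finset.mul_sum]
  obtain ⟨t, ht, hft⟩ := hf x
  have h2 : ‖1 - f x‖ = 1 - t := by
    rw [hft, ← Complex.ofReal_one, ← Complex.ofReal_sub, Complex.norm_real,
      Real.norm_of_nonneg (by linarith [ht.2])]
  have h3 := Sections.inner_self_apply ξ x
  have hS : (0 : ℝ) ≤ ∑ z ∈ (TopologicalCorrespondence.finite_fiber hP x).toFinset, ‖ξ z‖ ^ 2 :=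
    Finset.sum_nonneg fun _ _ => sq_nonneg _
  by_cases hx : ε ^ 2 ≤ ‖(inner C₀(X, ℂ) ξ ξ) x‖
  · rw [h x hx]
    simpa using sq_nonneg ε
  · rw [h3, Complex.norm_real, Real.norm_of_nonneg hS, not_le] at hx
    have h4 : ‖1 - f x‖ ^ 2 ≤ 1 := by rw [h2]; nlinarith [ht.1, ht.2]
    nlinarith

/-- The submodule `Γ₀(Z, r, s, L) C₀(U)` consists of the sections that vanish off `s⁻¹(U)`. -/
theorem mem_restrictSubmodule_iff [LocallyCompactSpace X] (ξ : P.Sections hP) :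
    ξ ∈ (P.sectionCorrespondence hP).restrictSubmodule U ↔ ∀ z, P.s z ∉ U → ξ z = 0 := by
  constructor
  · intro h z hz
    exact (Sections.inner_self_apply_eq_zero_iff ξ (P.s z)).1
      ((P.sectionCorrespondence hP).inner_eq_zero_of_notMem U ξ ξ h hz) z rfl
  · intro h
    refine Metric.mem_closure_iff.2 fun ε hε => ?_
    -- Since `⟨ξ,ξ⟩` vanishes off `U`, this superlevel set, compact in `X`, lies inside `U`. A
    -- cutoff equal to `1` on it moves `ξ` by at most `ε / 2`.
    have hKU : {x | (ε / 2) ^ 2 ≤ ‖(inner C₀(X, ℂ) ξ ξ) x‖} ⊆ (U : Set X) := by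
      intro x hx
      by_contra hxU
      have h0 := (Sections.inner_self_apply_eq_zero_iff ξ x).2 fun z hz => h z (by rwa [hz])
      rw [Set.mem_ofPred_eq, h0, norm_zero] at hx
      have : (0 : ℝ) < (ε / 2) ^ 2 := by positivity
      linarith
    obtain ⟨f, hf1, hf0, hf⟩ := C0.exists_bump
      (C0.isCompact_le_norm (inner C₀(X, ℂ) ξ ξ) (ε := (ε / 2) ^ 2) (by positivity)) U.isOpen hKU
    refine ⟨C0.extendZero U (C0.restrict U f hf0) • ξ, Submodule.subset_span ⟨_, ξ, rfl⟩, ?_⟩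
    have hext : C0.extendZero U (C0.restrict U f hf0) = f := by
      ext x
      by_cases hx : x ∈ U
      · exact C0.extendZero_apply U (C0.restrict U f hf0) ⟨x, hx⟩
      · rw [C0.extendZero_of_notMem U _ hx, hf0 x hx]
    rw [hext]
    refine lt_of_le_of_lt ?_ (half_lt_self hε)
    refine (dist_eq_norm (E := P.Sections hP) ξ (f • ξ)).trans_le ?_
    exact Sections.norm_sub_smul_le hf ξ (by positivity) hf1

variable (P hP U)

/-- The underlying space of the C*-correspondence `Γ₀(Z, r, s, L) C₀(U)`. -/
abbrev RestrictedSections : Type _ := ((P.sectionCorrespondence hP).restrict U).Carrier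

/-- The sections over `Z` underlying the elements of `Γ₀(Z, r, s, L) C₀(U)`. -/
def evalRestrict (z : P.Z) : P.RestrictedSections hP U →ₗ[ℂ] P.L z where
  toFun ξ := (show P.Sections hP from (Subtype.val ξ)) z
  map_add' _ _ := rfl
  map_smul' _ _ := rfl

variable {P hP U}

theorem ext_evalRestrict {ξ η : P.RestrictedSections hP U}
    (h : ∀ z, evalRestrict P hP U z ξ = evalRestrict P hP U z η) : ξ = η :=
  Subtype.ext (Sections.ext h)

theorem isC0Section_evalRestrict (ξ : P.RestrictedSections hP U) :
    P.IsC0Section fun z => evalRestrict P hP U z ξ :=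
  Sections.isC0Section (P := P) (hP := hP) (Subtype.val ξ)

theorem evalRestrict_smul (f : C₀(U, ℂ)) (ξ : P.RestrictedSections hP U) (z : P.Z) :
    evalRestrict P hP U z (f • ξ) = C0.extendZero U f (P.s z) • evalRestrict P hP U z ξ := rfl

theorem evalRestrict_leftAction (g : C₀(Y, ℂ)) (ξ : P.RestrictedSections hP U) (z : P.Z) :
    evalRestrict P hP U z (((P.sectionCorrespondence hP).restrict U).leftAction g ξ) =
      g (P.r z) • evalRestrict P hP U z ξ := rfl

theorem inner_restrict_apply (ξ η : P.RestrictedSections hP U) (x : U) : (inner C₀(U, ℂ) ξ η) x =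
    P.sectionInner (fun z => evalRestrict P hP U z ξ) (fun z => evalRestrict P hP U z η) x := rfl

theorem inner_restrict_self_eq_zero_iff (ξ : P.RestrictedSections hP U) (x : U) :
    (inner C₀(U, ℂ) ξ ξ) x = 0 ↔ ∀ z, P.s z = x → evalRestrict P hP U z ξ = 0 :=
  Sections.inner_self_apply_eq_zero_iff (P := P) (hP := hP) (Subtype.val ξ) (x : X)

theorem evalRestrict_of_notMem [LocallyCompactSpace X] (ξ : P.RestrictedSections hP U) {z : P.Z}
    (hz : P.s z ∉ U) : evalRestrict P hP U z ξ = 0 :=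
  (mem_restrictSubmodule_iff (P := P) (hP := hP) (Subtype.val ξ)).1 ξ.2 z hz

variable (hP) in
theorem exists_evalRestrict_eq [LocallyCompactSpace X] {ξ : ∀ z, P.L z} (hξ : P.IsC0Section ξ)
    (h : ∀ z, P.s z ∉ U → ξ z = 0) :
    ∃ η : P.RestrictedSections hP U, ∀ z, evalRestrict P hP U z η = ξ z :=
  ⟨⟨(⟨ξ, hξ⟩ : P.Sections hP), (mem_restrictSubmodule_iff (hP := hP) ⟨ξ, hξ⟩).2 h⟩, fun _ => rfl⟩

variable (hP) in
theorem exists_bump_restrict [LocallyCompactSpace X] (z₀ : P.Z) {W : Set P.Z} (hW : IsOpen W)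
    (hz₀ : z₀ ∈ W) (hWU : W ⊆ P.s ⁻¹' U) :
    ∃ ξ : P.RestrictedSections hP U, evalRestrict P hP U z₀ ξ ≠ 0 ∧
      ∀ z ∉ W, evalRestrict P hP U z ξ = 0 := by
  obtain ⟨ξ, h0, hξ⟩ := Sections.exists_bump hP z₀ hW hz₀
  obtain ⟨η, hη⟩ := exists_evalRestrict_eq (U := U) hP ξ.isC0Section
    fun z hz => hξ z fun h => hz (hWU h)
  exact ⟨η, by rwa [hη], fun z hz => by rw [hη, hξ z hz]⟩

end Restrict
end TwistedTopologicalCorrespondence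

/-- A closed inclusion is proper. Closedness of the image enters both the triviality of the line
bundles and that of the coverings through this fact. -/
theorem TopologicalCorrespondence.RightProper.isProperMap {Y X : Type*} [TopologicalSpace Y]
    [TopologicalSpace X] {T : TopologicalCorrespondence Y X} (hT : T.RightProper)
    (hcl : IsClosed (Set.range T.s)) : IsProperMap T.s :=
  hcl.isClosedEmbedding_subtypeVal.isProperMap.comp hT

/-! ### Local conjugacy of the underlying topological correspondences -/

namespace TopologicalCorrespondence
variable {Y X : Type*} [TopologicalSpace Y] [TopologicalSpace X]
  {T : TopologicalCorrespondence Y X} {T' : TopologicalCorrespondence Y X} {U : Opens X}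

theorem Isomorphic.exists_homeomorph (h : (T.restrict U).Isomorphic (T'.restrict U)) :
    ∃ φ : T.s ⁻¹' (U : Set X) ≃ₜ T'.s ⁻¹' (U : Set X),
      (∀ z, T'.s (φ z) = T.s z) ∧ ∀ z, T'.r (φ z) = T.r z := by
  obtain ⟨φ, hs, hr⟩ := h
  exact ⟨φ, fun z => congrArg Subtype.val (hs z), hr⟩

theorem apply_symm_of_apply {φ : T.s ⁻¹' (U : Set X) ≃ₜ T'.s ⁻¹' (U : Set X)}
    (hs : ∀ z, T'.s (φ z) = T.s z) (z : T'.s ⁻¹' (U : Set X)) : T.s (φ.symm z) = T'.s z := by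
  rw [← hs, φ.apply_symm_apply]

theorem Isomorphic.exists_homeomorph_of_le {V : Opens X}
    (h : (T.restrict U).Isomorphic (T'.restrict U)) (hVU : V ≤ U) :
    ∃ φ : T.s ⁻¹' (V : Set X) ≃ₜ T'.s ⁻¹' (V : Set X),
      (∀ z, T'.s (φ z) = T.s z) ∧ ∀ z, T'.r (φ z) = T.r z := by
  obtain ⟨φ, hs, hr⟩ := h.exists_homeomorph
  refine ⟨⟨⟨fun z => ⟨φ ⟨z, hVU z.2⟩, ?_⟩, fun z => ⟨φ.symm ⟨z, hVU z.2⟩, ?_⟩, fun z => ?_,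
    fun z => ?_⟩, ?_, ?_⟩, fun z => hs _, fun z => hr _⟩
  · rw [Set.mem_preimage, hs]
    exact z.2
  · rw [Set.mem_preimage, apply_symm_of_apply hs]
    exact z.2
  · exact Subtype.ext (by simp)
  · exact Subtype.ext (by simp)
  · dsimp only
    fun_prop
  · dsimp only
    fun_prop

theorem LocallyConjugate.range_eq (h : T.LocallyConjugate T') :
    Set.range T.s = Set.range T'.s := by
  ext x
  obtain ⟨U, hx, hU⟩ := h x
  obtain ⟨φ, hs, -⟩ := hU.exists_homeomorph
  constructor
  · rintro ⟨z, rfl⟩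
    exact ⟨φ ⟨z, hx⟩, hs ⟨z, hx⟩⟩
  · rintro ⟨z, rfl⟩
    exact ⟨φ.symm ⟨z, hx⟩, apply_symm_of_apply hs ⟨z, hx⟩⟩

end TopologicalCorrespondence

/-! ### Local conjugacy implies local isomorphism -/

namespace TwistedTopologicalCorrespondence
variable {Y X : Type*} [TopologicalSpace Y] [TopologicalSpace X]
  {P : TwistedTopologicalCorrespondence Y X} {P' : TwistedTopologicalCorrespondence Y X}

/-- This trivializes the line bundle over the preimage of a neighbourhood of `x`. Fibres being
finite, bump sections add up to a section nonzero on the whole fibre, and the closed map `s` spreads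
this to nearby fibres. -/
theorem exists_section_ne_zero [T2Space X] [LocallyCompactSpace X] (hP : P.RightProper)
    (hcl : IsClosed (Set.range P.s)) (x : X) : ∃ V : Opens X, x ∈ V ∧ ∃ u : ∀ z, P.L z,
      P.IsContinuousSection u ∧ ∀ z, P.s z ∈ V → u z ≠ 0 := by
  have hfin := TopologicalCorrespondence.finite_fiber hP x
  have hb : ∀ z₀ : P.Z, P.s z₀ = x → ∃ ξ : P.RestrictedSections hP ⊤,
      evalRestrict P hP ⊤ z₀ ξ ≠ 0 ∧
      ∀ z, P.s z = x → z ≠ z₀ → evalRestrict P hP ⊤ z ξ = 0 := fun z₀ h₀ => by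
    obtain ⟨ξ, h1, h2⟩ := exists_bump_restrict (U := ⊤) hP z₀
      -- The neighbourhood excludes the other points of the fibre, so the bumps do not interfere
      -- there.
      (W := (P.s ⁻¹' {x} \ {z₀})ᶜ) (hfin.subset Set.sdiff_subset).isClosed.isOpen_compl
      (by simp) (fun _ _ => trivial)
    exact ⟨ξ, h1, fun z hz hne => h2 z (by simp [hz, hne])⟩
  have := hfin.fintype
  choose ξ hξ1 hξ2 using hb
  let ζ : P.RestrictedSections hP ⊤ := ∑ z : P.s ⁻¹' {x}, ξ z.1 z.2
  have hζ : ∀ z, P.s z = x → evalRestrict P hP ⊤ z ζ ≠ 0 := fun z hz => by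
    rw [map_sum, Finset.sum_eq_single (⟨z, hz⟩ : P.s ⁻¹' {x})]
    · exact hξ1 z hz
    · exact fun b _ hbz => hξ2 b.1 b.2 z hz fun h => hbz (Subtype.ext h.symm)
    · simp
  have hc := (isC0Section_evalRestrict ζ).1
  -- `V` is the complement of the image of the zero set. If `x` is not in the image of `s`, then `ζ`
  -- is an empty sum and `V` is the complement of the image.
  refine ⟨⟨(P.s '' {z | ‖evalRestrict P hP ⊤ z ζ‖ = 0})ᶜ,
    ((hP.isProperMap hcl).isClosedMap _ (isClosed_eq hc.norm continuous_const)).isOpen_compl⟩,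
    ?_, _, hc, fun z hz h0 => ?_⟩
  · rintro ⟨z, hz, hzx⟩
    exact hζ z hzx (norm_eq_zero.1 hz)
  · exact hz ⟨z, norm_eq_zero.2 h0, rfl⟩

section Transport
variable {U : Opens X}

open Classical in
/-- The section of `L'` corresponding to a section of `L` under a homeomorphism `φ` of the spaces
over `U`, and under the isomorphism of line bundles which maps a nonvanishing section `u` of `L`,
normalized, to a nonvanishing section `u'` of `L'`, normalized. -/
noncomputable def transport (φ : P.s ⁻¹' U ≃ₜ P'.s ⁻¹' U) (u : ∀ z, P.L z) (u' : ∀ z, P'.L z)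
    (ξ : ∀ z, P.L z) (z' : P'.Z) : P'.L z' :=
  -- The coefficient is the coordinate `⟨u,ξ⟩/‖u‖` of `ξ` in the unit frame `u/‖u‖`; the other
  -- factor normalizes `u'`.
  (if h : P'.s z' ∈ U then
    inner ℂ (u (φ.symm ⟨z', h⟩)) (ξ (φ.symm ⟨z', h⟩)) / (‖u (φ.symm ⟨z', h⟩)‖ * ‖u' z'‖ : ℂ)
    else 0) • u' z'

variable {φ : P.s ⁻¹' U ≃ₜ P'.s ⁻¹' U} {u : ∀ z, P.L z} {u' : ∀ z, P'.L z}

theorem transport_of_notMem {ξ : ∀ z, P.L z} {z' : P'.Z} (h : P'.s z' ∉ U) :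
    transport φ u u' ξ z' = 0 := by
  rw [transport, dif_neg h, zero_smul]

theorem transport_apply_symm (ξ : ∀ z, P.L z) (z' : P'.s ⁻¹' (U : Set X)) :
    transport φ u u' ξ z' = (inner ℂ (u (φ.symm z')) (ξ (φ.symm z')) /
      (‖u (φ.symm z')‖ * ‖u' z'‖ : ℂ)) • u' z' :=
  congrArg (· • u' z') (dif_pos z'.2)

theorem transport_apply (ξ : ∀ z, P.L z) (z : P.s ⁻¹' (U : Set X)) :
    transport φ u u' ξ (φ z) =
      (inner ℂ (u z) (ξ z) / (‖u z‖ * ‖u' (φ z)‖ : ℂ)) • u' (φ z) := by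
  rw [transport_apply_symm, φ.symm_apply_apply]

/-- The fibres are lines, and a unit vector goes to a unit vector. -/
theorem inner_transport (hu : ∀ z, P.s z ∈ U → u z ≠ 0) (hu' : ∀ z, P'.s z ∈ U → u' z ≠ 0)
    (ξ η : ∀ z, P.L z) (z : P.s ⁻¹' (U : Set X)) :
    inner ℂ (transport φ u u' ξ (φ z)) (transport φ u u' η (φ z)) = inner ℂ (ξ z) (η z) := by
  have h1 : (‖u z‖ : ℂ) ≠ 0 := by simpa using hu z z.2
  have h2 : (‖u' (φ z)‖ : ℂ) ≠ 0 := by simpa using hu' _ (φ z).2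
  rw [transport_apply, transport_apply]
  conv_rhs => rw [eq_inner_smul (hu z z.2) (ξ z), eq_inner_smul (hu z z.2) (η z)]
  simp only [inner_smul_left, inner_smul_right, inner_self_eq_norm_sq_to_K, map_div₀, map_mul,
    map_pow, Complex.conj_ofReal, Complex.coe_algebraMap]
  field_simp

theorem transport_symm_transport (hu : ∀ z, P.s z ∈ U → u z ≠ 0)
    (hu' : ∀ z, P'.s z ∈ U → u' z ≠ 0) {ξ : ∀ z, P.L z} (hξ : ∀ z, P.s z ∉ U → ξ z = 0) :
    transport φ.symm u' u (transport φ u u' ξ) = ξ := by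
  funext z
  by_cases hz : P.s z ∈ U
  · have h1 : (‖u z‖ : ℂ) ≠ 0 := by simpa using hu z hz
    have h2 : (‖u' (φ ⟨z, hz⟩)‖ : ℂ) ≠ 0 := by simpa using hu' _ (φ ⟨z, hz⟩).2
    refine (transport_apply_symm _ (⟨z, hz⟩ : P.s ⁻¹' (U : Set X))).trans ?_
    rw [Homeomorph.symm_symm, transport_apply, inner_smul_right, inner_self_eq_norm_sq_to_K]
    conv_rhs => rw [eq_inner_smul (hu z hz) (ξ z)]
    congr 1
    simp only [Complex.coe_algebraMap]
    field_simp
  · rw [transport_of_notMem hz, hξ z hz]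

theorem transport_add (ξ η : ∀ z, P.L z) : transport φ u u' (fun z => ξ z + η z) =
    fun z => transport φ u u' ξ z + transport φ u u' η z := by
  funext z
  by_cases hz : P'.s z ∈ U
  · simp only [transport, dif_pos hz, inner_add_right, add_div, add_smul]
  · simp only [transport_of_notMem hz, add_zero]

/-- One identity serves three purposes: `a` is a constant for complex linearity, a function of `s`
for the right action, and a function of `r` for the left action. -/
theorem transport_mul {a : P.Z → ℂ} {b : P'.Z → ℂ} (h : ∀ z, b (φ z) = a z) (ξ : ∀ z, P.L z) :
    transport φ u u' (fun z => a z • ξ z) = fun z => b z • transport φ u u' ξ z := by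
  funext z
  by_cases hz : P'.s z ∈ U
  · have := h (φ.symm ⟨z, hz⟩)
    rw [φ.apply_symm_apply] at this
    simp only [transport, dif_pos hz, inner_smul_right, ← this, mul_div_assoc, mul_smul]
  · simp only [transport_of_notMem hz, smul_zero]

/-- Over points of `U` the map `φ` is a bijection of fibres that matches the summands; elsewhere
every summand vanishes on both sides. -/
theorem sectionInner_transport (hs : ∀ z, P'.s (φ z) = P.s z) (hu : ∀ z, P.s z ∈ U → u z ≠ 0)
    (hu' : ∀ z, P'.s z ∈ U → u' z ≠ 0) (ξ : ∀ z, P.L z) {η : ∀ z, P.L z}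
    (hη : ∀ z, P.s z ∉ U → η z = 0) (x : X) :
    P'.sectionInner (transport φ u u' ξ) (transport φ u u' η) x = P.sectionInner ξ η x := by
  by_cases hx : x ∈ U
  · have hs' : ∀ z, P.s (φ.symm z) = P'.s z := fun z => by rw [← hs, φ.apply_symm_apply]
    refine (finsum_eq_of_bijective (fun z : P.s ⁻¹' {x} =>
      (⟨φ ⟨z, by rw [Set.mem_preimage, z.2]; exact hx⟩, (hs _).trans z.2⟩ : P'.s ⁻¹' {x}))
      ⟨fun a b hab => ?_, fun z => ?_⟩ fun z => ?_).symm
    · have h1 := φ.injective (Subtype.ext (congrArg (fun w : P'.s ⁻¹' {x} => (w : P'.Z)) hab))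
      exact Subtype.ext (congrArg (fun w : P.s ⁻¹' (U : Set X) => (w : P.Z)) h1)
    · have hz : P'.s z ∈ U := by rw [z.2]; exact hx
      exact ⟨⟨φ.symm ⟨z, hz⟩, (hs' _).trans z.2⟩, Subtype.ext (by simp)⟩
    · exact (inner_transport hu hu' ξ η (⟨z, by rw [Set.mem_preimage, z.2]; exact hx⟩)).symm
  · rw [sectionInner, sectionInner, TopologicalCorrespondence.fiberSum,
      TopologicalCorrespondence.fiberSum, finsum_eq_zero_of_forall_eq_zero,
      finsum_eq_zero_of_forall_eq_zero]
    · intro z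
      rw [hη z (by rw [z.2]; exact hx), inner_zero_right]
    · intro z
      rw [transport_of_notMem (by rw [z.2]; exact hx), inner_zero_left]

/-- The function `⟨ξ,ξ⟩` is preserved, so only continuity is at stake. Over `U` it follows from the
frames. At the remaining points, boundary points included, the norm squared is bounded by `⟨ξ,ξ⟩ ∘
s'`, which is continuous and vanishes there. -/
theorem isC0Section_transport [T2Space X] (hP : P.RightProper) (hP' : P'.RightProper)
    (hs : ∀ z, P'.s (φ z) = P.s z) (hu : ∀ z, P.s z ∈ U → u z ≠ 0)
    (hu' : ∀ z, P'.s z ∈ U → u' z ≠ 0) (huc : P.IsContinuousSection u)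
    (huc' : P'.IsContinuousSection u') {ξ : ∀ z, P.L z} (hξ : P.IsC0Section ξ)
    (hξU : ∀ z, P.s z ∉ U → ξ z = 0) : P'.IsC0Section (transport φ u u' ξ) := by
  obtain ⟨hξc, g, hg⟩ := hξ
  have hgt : ∀ x, g x = P'.sectionInner (transport φ u u' ξ) (transport φ u u' ξ) x := fun x => by
    rw [sectionInner_transport hs hu hu' ξ hξU, hg]
  refine ⟨continuous_iff_continuousAt.2 fun z₀ => ?_, g, hgt⟩
  by_cases hz₀ : P'.s z₀ ∈ U
  · refine continuousAt_smul_section ?_ huc'.continuousAt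
    have hopen : IsOpen (P'.s ⁻¹' (U : Set X)) :=
      U.isOpen.preimage P'.isLocalHomeomorph_s.continuous
    rw [← (hopen.isOpenEmbedding_subtypeVal).continuousAt_iff (x := ⟨z₀, hz₀⟩)]
    refine Continuous.continuousAt ?_
    have hv : Continuous fun z' : P'.s ⁻¹' (U : Set X) => (φ.symm z' : P.Z) := by fun_prop
    have h1 := (huc.inner hξc).comp hv
    have h2 := huc.norm.comp hv
    have h3 := huc'.norm.comp (continuous_subtype_val (p := (· ∈ P'.s ⁻¹' (U : Set X))))
    have h4 : Continuous fun z' : P'.s ⁻¹' (U : Set X) =>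
        inner ℂ (u (φ.symm z')) (ξ (φ.symm z')) / (‖u (φ.symm z')‖ * ‖u' z'‖ : ℂ) := by
      refine h1.div ((Complex.continuous_ofReal.comp h2).mul (Complex.continuous_ofReal.comp h3))
        fun z' => mul_ne_zero ?_ ?_
      · simpa using hu _ (φ.symm z').2
      · simpa using hu' _ z'.2
    exact h4.congr fun z' => by
      rw [Function.comp_apply, dif_pos (show P'.s z' ∈ U from z'.2)]
  · have h0 : transport φ u u' ξ z₀ = 0 := transport_of_notMem hz₀
    refine continuousAt_section_of_norm h0 ?_
    have hg0 : g (P'.s z₀) = 0 := by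
      rw [hg, sectionInner_self hP, Finset.sum_eq_zero, Complex.ofReal_zero]
      intro z hz
      have hz' : P.s z = P'.s z₀ := by simpa using hz
      rw [hξU z (by rwa [hz'])]
      simp
    have hlim : Tendsto (fun z => √‖g (P'.s z)‖) (𝓝 z₀) (𝓝 0) := by
      have h1 : Continuous fun z => √‖g (P'.s z)‖ :=
        (((map_continuous g).comp P'.isLocalHomeomorph_s.continuous).norm).sqrt
      simpa [hg0] using h1.tendsto z₀
    refine squeeze_zero (fun _ => norm_nonneg _) (fun z => ?_) hlim
    refine Real.le_sqrt_of_sq_le ?_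
    rw [hgt, sectionInner_self hP', Complex.norm_real]
    refine le_trans ?_ (le_abs_self _)
    exact Finset.single_le_sum (f := fun z => ‖transport φ u u' ξ z‖ ^ 2)
      (fun _ _ => sq_nonneg _) (by simp)

end Transport

/-- On a common neighbourhood where the homeomorphism and both frames exist, transport is the
isomorphism, with transport along `φ.symm` as inverse. -/
theorem LocallyConjugate.locallyIsomorphic [T2Space X] [LocallyCompactSpace X]
    (hP : P.RightProper) (hP' : P'.RightProper)
    (hcl : IsClosed (Set.range P.s)) (hcl' : IsClosed (Set.range P'.s))
    (h : P.LocallyConjugate P') :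
    (P.sectionCorrespondence hP).LocallyIsomorphic (P'.sectionCorrespondence hP') := by
  intro x
  obtain ⟨U₀, hx₀, hU₀⟩ := h x
  obtain ⟨V, hxV, u, huc, hu⟩ := exists_section_ne_zero hP hcl x
  obtain ⟨V', hxV', u', huc', hu'⟩ := exists_section_ne_zero hP' hcl' x
  let U : Opens X := U₀ ⊓ V ⊓ V'
  obtain ⟨φ, hs, hr⟩ := hU₀.exists_homeomorph_of_le (V := U) (inf_le_left.trans inf_le_left)
  replace hu : ∀ z, P.s z ∈ U → u z ≠ 0 := fun z hz => hu z hz.1.2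
  replace hu' : ∀ z, P'.s z ∈ U → u' z ≠ 0 := fun z hz => hu' z hz.2
  have hs' := TopologicalCorrespondence.apply_symm_of_apply hs
  refine ⟨U, ⟨⟨hx₀, hxV⟩, hxV'⟩, ?_⟩
  have hT : ∀ ξ : P.RestrictedSections hP U, ∃ η : P'.RestrictedSections hP' U, ∀ z,
      evalRestrict P' hP' U z η = transport φ u u' (fun z => evalRestrict P hP U z ξ) z := fun ξ =>
    exists_evalRestrict_eq hP' (isC0Section_transport hP hP' hs hu hu' huc huc'
      (isC0Section_evalRestrict ξ) fun z hz => evalRestrict_of_notMem ξ hz)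
      fun z hz => transport_of_notMem hz
  have hS : ∀ ξ : P'.RestrictedSections hP' U, ∃ η : P.RestrictedSections hP U, ∀ z,
      evalRestrict P hP U z η =
        transport φ.symm u' u (fun z => evalRestrict P' hP' U z ξ) z := fun ξ =>
    exists_evalRestrict_eq hP (isC0Section_transport hP' hP hs' hu' hu huc' huc
      (isC0Section_evalRestrict ξ) fun z hz => evalRestrict_of_notMem ξ hz)
      fun z hz => transport_of_notMem hz
  choose T hT using hT
  choose S hS using hS
  have hmul : ∀ {a : P.Z → ℂ} {b : P'.Z → ℂ} {ξ η : P.RestrictedSections hP U},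
      (∀ z, b (φ z) = a z) → (∀ z, evalRestrict P hP U z ξ = a z • evalRestrict P hP U z η) →
      ∀ z, evalRestrict P' hP' U z (T ξ) = b z • evalRestrict P' hP' U z (T η) := by
    intro a b ξ η hab h z
    rw [hT, hT, funext h, transport_mul hab]
  refine ⟨⟨⟨⟨T, fun ξ η => ext_evalRestrict fun z => ?_⟩, fun c ξ => ext_evalRestrict fun z => ?_⟩,
    S, fun ξ => ext_evalRestrict fun z => ?_, fun ξ => ext_evalRestrict fun z => ?_⟩,
    fun ξ η => ?_, fun f ξ => ext_evalRestrict fun z => ?_,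
    fun g ξ => ext_evalRestrict fun z => ?_⟩
  · simp only [map_add, hT, transport_add]
  · exact (hmul (ξ := c • ξ) (η := ξ) (a := fun _ => c) (b := fun _ => c) (fun _ => rfl)
      (fun z => (evalRestrict P hP U z).map_smul c ξ) z).trans
      ((evalRestrict P' hP' U z).map_smul c (T ξ)).symm
  · rw [hS, funext (hT ξ), transport_symm_transport hu hu' fun z hz => evalRestrict_of_notMem ξ hz]
  · have := transport_symm_transport (φ := φ.symm) hu' hu
      fun z (hz : P'.s z ∉ U) => evalRestrict_of_notMem ξ hz
    rw [Homeomorph.symm_symm] at this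
    change evalRestrict P' hP' U z (T (S ξ)) = _
    rw [hT, funext (hS ξ), this]
  · ext y
    rw [inner_restrict_apply, inner_restrict_apply]
    change P'.sectionInner (fun z => evalRestrict P' hP' U z (T ξ))
      (fun z => evalRestrict P' hP' U z (T η)) y = _
    rw [funext (hT ξ), funext (hT η)]
    exact sectionInner_transport hs hu hu' _ (fun z hz => evalRestrict_of_notMem η hz) y
  · rw [evalRestrict_smul]
    exact hmul (a := fun z => C0.extendZero U f (P.s z)) (b := fun z => C0.extendZero U f (P'.s z))
      (fun z => by rw [hs]) (fun z => evalRestrict_smul f ξ z) z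
  · rw [evalRestrict_leftAction]
    exact hmul (a := fun z => g (P.r z)) (b := fun z => g (P'.r z))
      (fun z => by rw [hr]) (fun z => evalRestrict_leftAction g ξ z) z

end TwistedTopologicalCorrespondence

/-! ### Local isomorphism implies local conjugacy: linear algebra and coverings -/

/-- A nonsingular square matrix has a nonzero generalized diagonal. -/
theorem LinearIndependent.exists_equiv_apply_ne_zero {K I I' : Type*} [Field K] [Finite I]
    [Finite I'] {M : I' → Type*} [∀ i, AddCommGroup (M i)] [∀ i, Module K (M i)]
    (hM : ∀ i, Module.finrank K (M i) = 1) {v : I → ∀ i, M i} (hv : LinearIndependent K v)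
    (hc : Nat.card I = Nat.card I') : ∃ σ : I ≃ I', ∀ i, v i (σ i) ≠ 0 := by
  classical
  have := Fintype.ofFinite I
  let e : I ≃ I' := (Finite.card_eq.1 hc).some
  have hfd : ∀ i, FiniteDimensional K (M i) := fun i =>
    .of_finrank_pos (by rw [hM]; exact one_pos)
  have b : ∀ i, M i ≃ₗ[K] K := fun i =>
    LinearEquiv.ofFinrankEq (M i) K ((hM i).trans (Module.finrank_self K).symm)
  let A : Matrix I I K := fun i j => b (e j) (v i (e j))
  have hA : LinearIndependent K A.row :=
    hv.map' ((LinearEquiv.piCongrRight b).trans (LinearEquiv.funCongrLeft K K e)).toLinearMap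
      (LinearEquiv.ker _)
  have hdet : A.det ≠ 0 :=
    ((Matrix.isUnit_iff_isUnit_det A).1 (Matrix.linearIndependent_rows_iff_isUnit.1 hA)).ne_zero
  -- Some Leibniz term is nonzero. Its factors are `A (τ i) i`, so row `i` is paired with column
  -- `τ.symm i`.
  rw [Matrix.det_apply] at hdet
  obtain ⟨τ, -, hτ⟩ := Finset.exists_ne_zero_of_sum_ne_zero hdet
  refine ⟨τ.symm.trans e, fun i h => hτ ?_⟩
  rw [Finset.prod_eq_zero (Finset.mem_univ (τ.symm i)), smul_zero]
  simp only [A, Equiv.apply_symm_apply]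
  rw [Equiv.trans_apply] at h
  rw [h, map_zero]

theorem CStarCorrespondence.Isomorphic.symm {Y X : Type*} [TopologicalSpace Y] [TopologicalSpace X]
    {E : CStarCorrespondence Y X} {F : CStarCorrespondence Y X} (h : E.Isomorphic F) :
    F.Isomorphic E := by
  obtain ⟨T, h1, h2, h3⟩ := h
  refine ⟨T.symm, fun ξ η => ?_, fun f ξ => T.injective ?_, fun g ξ => T.injective ?_⟩
  · rw [← h1, T.apply_symm_apply, T.apply_symm_apply]
  · rw [h2, T.apply_symm_apply, T.apply_symm_apply]
  · rw [h3, T.apply_symm_apply, T.apply_symm_apply]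

namespace TopologicalCorrespondence
variable {Y X : Type*} [TopologicalSpace Y] [TopologicalSpace X]
  {T : TopologicalCorrespondence Y X} {T' : TopologicalCorrespondence Y X}

/-- A closed local homeomorphism with finite fibres is a covering onto all of `X`, with empty fibres
allowed. -/
theorem exists_trivialization (hT : T.RightProper) (hcl : IsClosed (Set.range T.s)) (x : X) :
    DiscreteTopology (T.s ⁻¹' {x}) ∧ ∃ V : Set X, x ∈ V ∧ IsOpen V ∧
      ∃ H : T.s ⁻¹' V ≃ₜ V × T.s ⁻¹' {x}, ∀ z, ((H z).1 : X) = T.s z := by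
  have hcov : IsCoveringMapOn T.s Set.univ :=
    (hT.isProperMap hcl).isClosedMap.isCoveringMapOn_of_isLocalHomeomorphOn
      (fun y _ => finite_fiber hT y)
      (T.isLocalHomeomorph_s.isLocalHomeomorphOn.mono fun _ _ => trivial)
  obtain ⟨hd, V, hx, hV, -, H, hH⟩ := hcov x trivial
  exact ⟨hd, V, hx, hV, H, hH⟩

/-- Two trivial coverings with fibres of the same cardinality are homeomorphic over the base. -/
theorem isomorphic_restrict_of_trivialization {I I' : Type*} [TopologicalSpace I]
    [DiscreteTopology I] [TopologicalSpace I'] [DiscreteTopology I'] {V V' : Set X}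
    (H : T.s ⁻¹' V ≃ₜ V × I) (hH : ∀ z, ((H z).1 : X) = T.s z)
    (H' : T'.s ⁻¹' V' ≃ₜ V' × I') (hH' : ∀ z, ((H' z).1 : X) = T'.s z) (σ : I ≃ I') (U : Opens X)
    (hUV : (U : Set X) ⊆ V) (hUV' : (U : Set X) ⊆ V')
    (hr : ∀ x (hx : x ∈ U) (i : I),
      T'.r (H'.symm (⟨x, hUV' hx⟩, σ i)) = T.r (H.symm (⟨x, hUV hx⟩, i))) :
    (T.restrict U).Isomorphic (T'.restrict U) := by
  have hs : ∀ p, T.s (H.symm p) = p.1 := fun p => by rw [← hH, H.apply_symm_apply]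
  have hs' : ∀ p, T'.s (H'.symm p) = p.1 := fun p => by rw [← hH', H'.apply_symm_apply]
  -- A point is determined by its base point and its sheet.
  have key : ∀ (z : T.s ⁻¹' V) x (hx : x ∈ V), x = T.s z → H.symm (⟨x, hx⟩, (H z).2) = z :=
    fun z x hx h => by
      rw [H.symm_apply_eq]
      exact Prod.ext (Subtype.ext (h.trans (hH z).symm)) rfl
  have key' : ∀ (z : T'.s ⁻¹' V') x (hx : x ∈ V'), x = T'.s z → H'.symm (⟨x, hx⟩, (H' z).2) = z :=
    fun z x hx h => by
      rw [H'.symm_apply_eq]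
      exact Prod.ext (Subtype.ext (h.trans (hH' z).symm)) rfl
  have hσ : Continuous σ := continuous_of_discreteTopology
  have hσ' : Continuous σ.symm := continuous_of_discreteTopology
  have hc := T.isLocalHomeomorph_s.continuous
  have hc' := T'.isLocalHomeomorph_s.continuous
  let f : T.s ⁻¹' (U : Set X) → T'.s ⁻¹' (U : Set X) := fun z =>
    ⟨H'.symm (⟨T.s z, hUV' z.2⟩, σ (H ⟨z, hUV z.2⟩).2), by
      rw [Set.mem_preimage, hs']; exact z.2⟩
  let g : T'.s ⁻¹' (U : Set X) → T.s ⁻¹' (U : Set X) := fun z =>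
    ⟨H.symm (⟨T'.s z, hUV z.2⟩, σ.symm (H' ⟨z, hUV' z.2⟩).2), by
      rw [Set.mem_preimage, hs]; exact z.2⟩
  have hr' : ∀ z : T.s ⁻¹' (U : Set X), T'.r (f z) = T.r z := fun z =>
    (hr (T.s z) z.2 (H ⟨z, hUV z.2⟩).2).trans
      (congrArg (fun w : T.s ⁻¹' V => T.r w) (key ⟨z, hUV z.2⟩ _ _ rfl))
  let φ : T.s ⁻¹' (U : Set X) ≃ₜ T'.s ⁻¹' (U : Set X) :=
    ⟨⟨f, g, fun z => Subtype.ext ?_, fun z => Subtype.ext ?_⟩, ?_, ?_⟩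
  · exact ⟨φ, fun z => Subtype.ext (hs' _), hr'⟩
  · simp only [f, g, Subtype.coe_eta, Homeomorph.apply_symm_apply, Equiv.symm_apply_apply]
    exact congrArg Subtype.val (key ⟨z, hUV z.2⟩ _ _ (hs' _))
  · simp only [f, g, Subtype.coe_eta, Homeomorph.apply_symm_apply, Equiv.apply_symm_apply]
    exact congrArg Subtype.val (key' ⟨z, hUV' z.2⟩ _ _ (hs _))
  · change Continuous f
    fun_prop
  · change Continuous g
    fun_prop

end TopologicalCorrespondence

/-! ### Reading off the fibres and the range map from an isomorphism -/

namespace TwistedTopologicalCorrespondence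
variable {Y X : Type*} [TopologicalSpace Y] [TopologicalSpace X] [T2Space X]
  {P : TwistedTopologicalCorrespondence Y X}
  {P' : TwistedTopologicalCorrespondence Y X} {hP : P.RightProper} {hP' : P'.RightProper}
  {U : Opens X}

/-- Vanishing on the fibre over `x` means `⟨ξ,ξ⟩(x) = 0`, which `T` preserves. Thus `T` descends to
an injective map between the spaces of values on the two fibres. -/
theorem evalRestrict_eq_zero_iff_of_inner
    {T : P.RestrictedSections hP U ≃ₗ[ℂ] P'.RestrictedSections hP' U}
    (hT : ∀ ξ η, inner C₀(U, ℂ) (T ξ) (T η) = inner C₀(U, ℂ) ξ η)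
    (ξ : P.RestrictedSections hP U) {x : X} (hx : x ∈ U) :
    (∀ z, P'.s z = x → evalRestrict P' hP' U z (T ξ) = 0) ↔
      ∀ z, P.s z = x → evalRestrict P hP U z ξ = 0 := by
  rw [← inner_restrict_self_eq_zero_iff (T ξ) ⟨x, hx⟩, ← inner_restrict_self_eq_zero_iff ξ ⟨x, hx⟩,
    hT]

/-- If a combination of the `T ξ_i` vanishes on the fibre, so does the same combination of the
`ξ_i`; at `p i` only the `i`-th term survives. -/
theorem linearIndependent_evalRestrict
    {T : P.RestrictedSections hP U ≃ₗ[ℂ] P'.RestrictedSections hP' U}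
    (hT : ∀ ξ η, inner C₀(U, ℂ) (T ξ) (T η) = inner C₀(U, ℂ) ξ η) {x : X} (hx : x ∈ U)
    {I : Type*} [Finite I] (p : I → P.Z) (hp : ∀ i, P.s (p i) = x)
    (ξ : I → P.RestrictedSections hP U) (h1 : ∀ i, evalRestrict P hP U (p i) (ξ i) ≠ 0)
    (h2 : ∀ i j, i ≠ j → evalRestrict P hP U (p i) (ξ j) = 0)
    {I' : Type*} (q : I' → P'.Z) (hq : ∀ z, P'.s z = x → ∃ i, q i = z) :
    LinearIndependent ℂ fun i j => evalRestrict P' hP' U (q j) (T (ξ i)) := by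
  have := Fintype.ofFinite I
  rw [Fintype.linearIndependent_iff]
  intro c hc i
  have h3 : ∀ z, P.s z = x → evalRestrict P hP U z (∑ j, c j • ξ j) = 0 := by
    refine (evalRestrict_eq_zero_iff_of_inner hT _ hx).1 fun z hz => ?_
    obtain ⟨j, rfl⟩ := hq z hz
    simpa using congrFun hc j
  have h4 := h3 (p i) (hp i)
  rw [map_sum, Finset.sum_eq_single i (fun j _ hj => by
    rw [map_smul, h2 i j hj.symm, smul_zero]) (by simp), map_smul] at h4
  exact (smul_eq_zero.1 h4).resolve_right (h1 i)

/-- If `T ξ` is nonzero at `z'`, where `ξ` is supported at the only point `z` of the fibre,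
then the range map takes the same value at `z` and at `z'`. -/
theorem r_eq_of_evalRestrict_ne_zero [T2Space Y] [LocallyCompactSpace Y]
    {T : P.RestrictedSections hP U ≃ₗ[ℂ] P'.RestrictedSections hP' U}
    (hT : ∀ ξ η, inner C₀(U, ℂ) (T ξ) (T η) = inner C₀(U, ℂ) ξ η)
    (hTl : ∀ g ξ, T (((P.sectionCorrespondence hP).restrict U).leftAction g ξ) =
      ((P'.sectionCorrespondence hP').restrict U).leftAction g (T ξ))
    {ξ : P.RestrictedSections hP U} {z : P.Z} {z' : P'.Z} (hz : P.s z ∈ U)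
    (hzz' : P'.s z' = P.s z)
    (hξ : ∀ w, P.s w = P.s z → w ≠ z → evalRestrict P hP U w ξ = 0)
    (hz' : evalRestrict P' hP' U z' (T ξ) ≠ 0) : P'.r z' = P.r z := by
  -- If `g(r(z)) = 0`, then `g` annihilates `ξ` on the whole fibre, hence also `T ξ`; as `T ξ` is
  -- nonzero at `z'`, this gives `g(r'(z')) = 0`.
  refine (C0.eq_of_forall_apply_eq_zero fun g hg => ?_).symm
  have h1 := (evalRestrict_eq_zero_iff_of_inner hT
    (((P.sectionCorrespondence hP).restrict U).leftAction g ξ) hz).2 (fun w hw => by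
      rw [evalRestrict_leftAction]
      by_cases hwz : w = z
      · rw [hwz, hg, zero_smul]
      · rw [hξ w hw hwz, smul_zero]) z' hzz'
  rw [hTl, evalRestrict_leftAction] at h1
  exact (smul_eq_zero.1 h1).resolve_right hz'

variable [LocallyCompactSpace X]

/-- The images of bumps at the points of one fibre are independent in the product of the lines over
the other, whose dimension is its number of points. The inverse isomorphism gives the reverse
inequality. -/
theorem card_fiber_le (h : ((P.sectionCorrespondence hP).restrict U).Isomorphic
    ((P'.sectionCorrespondence hP').restrict U)) {x : X} (hx : x ∈ U) :
    Nat.card (P.s ⁻¹' {x}) ≤ Nat.card (P'.s ⁻¹' {x}) := by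
  obtain ⟨T, hT, -⟩ := h
  have hfin := TopologicalCorrespondence.finite_fiber hP x
  have hb : ∀ p : P.s ⁻¹' {x}, ∃ ξ : P.RestrictedSections hP U,
      evalRestrict P hP U p ξ ≠ 0 ∧
      ∀ q : P.s ⁻¹' {x}, q ≠ p → evalRestrict P hP U q ξ = 0 := fun p => by
    have hpU : P.s p ∈ U := by rw [p.2]; exact hx
    obtain ⟨ξ, h1, h2⟩ := exists_bump_restrict (U := U) hP p
      (W := (P.s ⁻¹' {x} \ {(p : P.Z)})ᶜ ∩ P.s ⁻¹' U)
      ((hfin.subset Set.sdiff_subset).isClosed.isOpen_compl.inter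
        (U.isOpen.preimage P.isLocalHomeomorph_s.continuous))
      ⟨by simp, hpU⟩ Set.inter_subset_right
    exact ⟨ξ, h1, fun q hq => h2 q fun h => h.1 ⟨q.2, fun h => hq (Subtype.ext h)⟩⟩
  choose ξ h1 h2 using hb
  have := hfin.fintype
  have := (TopologicalCorrespondence.finite_fiber hP' x).fintype
  have hli := linearIndependent_evalRestrict hT hx (fun p : P.s ⁻¹' {x} => (p : P.Z))
    (fun p => p.2) ξ h1 (fun i j hij => h2 j i hij)
    (fun p : P'.s ⁻¹' {x} => (p : P'.Z)) fun z hz => ⟨⟨z, hz⟩, rfl⟩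
  have hfd : ∀ z, FiniteDimensional ℂ (P'.L z) := fun z =>
    .of_finrank_pos (by rw [finrank_fiber]; exact one_pos)
  have h3 := hli.fintype_card_le_finrank
  rw [Module.finrank_pi_fintype] at h3
  simpa [finrank_fiber] using h3

theorem range_eq_of_locallyIsomorphic (h : (P.sectionCorrespondence hP).LocallyIsomorphic
    (P'.sectionCorrespondence hP')) : Set.range P.s = Set.range P'.s := by
  have key : ∀ x, x ∈ Set.range P.s ↔ 0 < Nat.card (P.s ⁻¹' {x}) := fun x => by
    have := (TopologicalCorrespondence.finite_fiber hP x).to_subtype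
    rw [Nat.card_pos_iff, and_iff_left this, Set.nonempty_coe_sort]
    rfl
  have key' : ∀ x, x ∈ Set.range P'.s ↔ 0 < Nat.card (P'.s ⁻¹' {x}) := fun x => by
    have := (TopologicalCorrespondence.finite_fiber hP' x).to_subtype
    rw [Nat.card_pos_iff, and_iff_left this, Set.nonempty_coe_sort]
    rfl
  ext x
  obtain ⟨U, hx, hU⟩ := h x
  rw [key, key', (card_fiber_le hU hx).antisymm (card_fiber_le hU.symm hx)]

/-- The sheets of the two coverings near `x` are matched by a nonzero generalized diagonal of `T` on
the fibre over `x`, and left linearity makes the matching respect the range maps. -/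
theorem locallyConjugate_of_locallyIsomorphic [T2Space Y] [LocallyCompactSpace Y]
    (hcl : IsClosed (Set.range P.s)) (hcl' : IsClosed (Set.range P'.s))
    (h : (P.sectionCorrespondence hP).LocallyIsomorphic (P'.sectionCorrespondence hP')) :
    P.LocallyConjugate P' := by
  intro x
  obtain ⟨U₀, hx₀, hU₀⟩ := h x
  have hcard := (card_fiber_le hU₀ hx₀).antisymm (card_fiber_le hU₀.symm hx₀)
  obtain ⟨T, hT, -, hTl⟩ := hU₀
  obtain ⟨hd, V, hxV, hV, H, hH⟩ := TopologicalCorrespondence.exists_trivialization hP hcl x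
  obtain ⟨hd', V', hxV', hV', H', hH'⟩ :=
    TopologicalCorrespondence.exists_trivialization hP' hcl' x
  have hfin := (TopologicalCorrespondence.finite_fiber hP x).to_subtype
  have hfin' := (TopologicalCorrespondence.finite_fiber hP' x).to_subtype
  have hs : ∀ p, P.s (H.symm p) = p.1 := fun p => by rw [← hH, H.apply_symm_apply]
  have hs' : ∀ p, P'.s (H'.symm p) = p.1 := fun p => by rw [← hH', H'.apply_symm_apply]
  have hc := P.isLocalHomeomorph_s.continuous
  have hc' := P'.isLocalHomeomorph_s.continuous
  -- `W i` is the sheet through the point `i`, as an open subset of `Z`. A section supported in it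
  -- has at most one nonzero value on each fibre over `V`.
  let W : P.s ⁻¹' {x} → Set P.Z := fun i => Subtype.val '' {z : P.s ⁻¹' V | (H z).2 = i}
  have hW : ∀ i, IsOpen (W i) := fun i =>
    (hV.preimage hc).isOpenMap_subtype_val _
      ((isOpen_discrete {i}).preimage (continuous_snd.comp H.continuous))
  have hWH : ∀ i y j, (H.symm (y, j) : P.Z) ∈ W i ↔ j = i := fun i y j => by
    constructor
    · rintro ⟨z, hz, hzy⟩
      rw [← hz, Subtype.ext hzy, H.apply_symm_apply]
    · rintro rfl
      exact ⟨H.symm (y, j), by simp, rfl⟩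
  have hb : ∀ i, ∃ ξ : P.RestrictedSections hP U₀,
      evalRestrict P hP U₀ (H.symm (⟨x, hxV⟩, i)) ξ ≠ 0 ∧
      ∀ z ∉ W i, evalRestrict P hP U₀ z ξ = 0 := fun i => by
    obtain ⟨ξ, h1, h2⟩ := exists_bump_restrict (U := U₀) hP (H.symm (⟨x, hxV⟩, i))
      (W := W i ∩ P.s ⁻¹' U₀) ((hW i).inter (U₀.isOpen.preimage hc))
      ⟨(hWH _ _ _).2 rfl, by rw [Set.mem_preimage, hs]; exact hx₀⟩ Set.inter_subset_right
    exact ⟨ξ, h1, fun z hz => h2 z fun h => hz h.1⟩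
  choose ξ hξ1 hξ2 using hb
  have hli := linearIndependent_evalRestrict hT hx₀ (fun i => (H.symm (⟨x, hxV⟩, i) : P.Z))
    (fun i => hs _) ξ hξ1 (fun i j hij => hξ2 j _ fun h => hij ((hWH _ _ _).1 h))
    (fun i => (H'.symm (⟨x, hxV'⟩, i) : P'.Z)) fun z hz => by
      have hzV : P'.s z ∈ V' := by rwa [hz]
      refine ⟨(H' ⟨z, hzV⟩).2, congrArg Subtype.val (a₂ := (⟨z, hzV⟩ : P'.s ⁻¹' V')) ?_⟩
      rw [H'.symm_apply_eq]
      exact Prod.ext (Subtype.ext (hz.symm.trans (hH' ⟨z, hzV⟩).symm)) rfl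
  obtain ⟨σ, hσ⟩ := hli.exists_equiv_apply_ne_zero (fun _ => finrank_fiber _) hcard
  let f : P.s ⁻¹' {x} → V' → ℝ := fun i y =>
    ‖evalRestrict P' hP' U₀ (H'.symm (y, σ i)) (T (ξ i))‖
  have hf : ∀ i, Continuous (f i) := fun i =>
    (isC0Section_evalRestrict (T (ξ i))).1.norm.comp (by fun_prop)
  -- Nonvanishing of `T ξ_i` on the sheet `σ i` persists near `x` by continuity; finiteness of the
  -- fibre allows one neighbourhood for all `i`.
  let O : Opens X := ⟨⋂ i, Subtype.val '' {y | f i y ≠ 0}, isOpen_iInter_of_finite fun i =>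
    hV'.isOpenMap_subtype_val _ (isOpen_ne_fun (hf i) continuous_const)⟩
  refine ⟨U₀ ⊓ ⟨V, hV⟩ ⊓ ⟨V', hV'⟩ ⊓ O, ⟨⟨⟨hx₀, hxV⟩, hxV'⟩, Set.mem_iInter.2 fun i =>
    ⟨⟨x, hxV'⟩, norm_ne_zero_iff.2 (hσ i), rfl⟩⟩, ?_⟩
  refine TopologicalCorrespondence.isomorphic_restrict_of_trivialization H hH H' hH' σ _
    (fun y hy => hy.1.1.2) (fun y hy => hy.1.2) fun y hy i => ?_
  have hyV : y ∈ V := hy.1.1.2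
  -- Over `y`, only the nonvanishing of `T ξ_i` and the support of `ξ_i` are needed, not that `ξ_i`
  -- is nonzero there.
  refine r_eq_of_evalRestrict_ne_zero hT hTl (ξ := ξ i) ?_ ?_ (fun w hw hne => hξ2 i w ?_) ?_
  · rw [hs]
    exact hy.1.1.1
  · rw [hs, hs']
  · rintro ⟨z, hz, rfl⟩
    refine hne (congrArg Subtype.val (a₁ := z) ?_)
    rw [H.eq_symm_apply]
    exact Prod.ext (Subtype.ext ((hH z).trans (hw.trans (hs _)))) hz
  · obtain ⟨y', hy', rfl⟩ := Set.mem_iInter.1 hy.2 i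
    exact norm_ne_zero_iff.1 hy'

end TwistedTopologicalCorrespondence

/-! ### The equivalence -/

theorem mainTheorem8 {Y : Type*} {X : Type*}
    [TopologicalSpace Y] [T2Space Y] [LocallyCompactSpace Y]
    [TopologicalSpace X] [T2Space X] [LocallyCompactSpace X]
    (P : TwistedTopologicalCorrespondence Y X) (P' : TwistedTopologicalCorrespondence Y X)
    (hP : P.IsProper) (hP' : P'.IsProper)
    (hcl : IsClosed (Set.range P.s) ∨ IsClosed (Set.range P'.s)) :
    P.LocallyConjugate P' ↔
      (P.sectionCorrespondence hP.right).LocallyIsomorphic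
        (P'.sectionCorrespondence hP'.right) := by
  -- Each condition forces the images to coincide, so closedness of one gives closedness of both.
  have key : Set.range P.s = Set.range P'.s →
      IsClosed (Set.range P.s) ∧ IsClosed (Set.range P'.s) := fun h => by
    rw [← h, or_self] at hcl
    exact ⟨hcl, h ▸ hcl⟩
  constructor
  · intro h
    obtain ⟨h1, h2⟩ := key (TopologicalCorrespondence.LocallyConjugate.range_eq h)
    exact h.locallyIsomorphic hP.right hP'.right h1 h2
  · intro h
    obtain ⟨h1, h2⟩ := key (TwistedTopologicalCorrespondence.range_eq_of_locallyIsomorphic h)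
    exact TwistedTopologicalCorrespondence.locallyConjugate_of_locallyIsomorphic h1 h2 h
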